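/- **Definitions.** For a complex finite-dimensional Lie algebra $\mathfrak g$ and $x\in\mathfrak g^*$ let $\mathcal A_x(u,v)=\langle x,[u,v]\rangle$. By the Jordan--Kronecker theorem, for every pair $A,B$ of skew-symmetric bilinear forms on a finite-dimensional complex vector space there is a basis in which both matrices are block-diagonal with corresponding pairs of blocks of the form $$A_i=\begin{pmatrix}0&Q\\-Q^T&0\end{pmatrix},\qquad B_i=\begin{pmatrix}0&R\\-R^T&0\end{pmatrix},$$ where either $(Q,R)=(J_n(\lambda),I_n)$ with $n\ge1$ and $\lambda\in\mathbb C$ (a Jordan $2n\times2n$ block with eigenvalue $\lambda$; $J_n(\lambda)$ is the upper triangular $n\times n$ Jordan cell), or $(Q,R)=(I_n,J_n(0))$ with $n\ge1$ (a Jordan $2n\times 2n$ block with eigenvalue $\infty$), or $Q=(I_{k-1}\;\,0)$, $R=(0\;\,I_{k-1})$ of size $(k-1)\times k$ with $k\ge1$ (a Kronecker $(2k-1)\times(2k-1)$ block). The algebraic type of the pencil $A+\lambda B$ consists of the multiset of sizes $2k-1$ of its Kronecker blocks and the multiset of its Jordan tuples: for each eigenvalue, the tuple (up to order) of the sizes $2n$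 of the Jordan blocks with that eigenvalue. The Jordan--Kronecker (JK) invariants of $\mathfrak g$ are the common algebraic type of the pencils $\mathcal A_x+\lambda\mathcal A_a$ for all $(x,a)$ in some non-empty Zariski open subset of $\mathfrak g^*\times\mathfrak g^*$. **Theorem.** (1) Let $N\ge0$, let $p_t\ge1$ for $t=1,\dots,N$ and $n_{ti}\ge1$ for $i=1,\dots,p_t$, and let $(\alpha_t,\beta_t)\in\mathbb C^2\setminus\{0\}$, $t=1,\dots,N$, be pairwise non-proportional. Then there is a complex Lie algebra with a basis $g,h_1,h_2,e^i_{tj},f^i_{tj}$ ($t=1,\dots,N$, $i=1,\dots,p_t$, $j=1,\dots,n_{ti}$) and the relations $$[g,h_1]=h_1,\qquad [g,h_2]=h_2,\qquad [g,e^i_{tj}]=e^i_{tj},\qquad [e^i_{tj},f^i_{tk}]=\begin{cases}e^i_{t,j-k},&j>k,\\ \alpha_th_1+\beta_th_2,&j=k,\end{cases}$$ all other brackets of basis vectors (up to skew symmetry) being zero. Every such Lie algebra has as JK invariants exactly one Kronecker block, of size $3\times3$, and the $N$ Jordan tuples $(2n_{t1},\dots,2n_{tp_t})$, $t=1,\dots,N$,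 belonging to $N$ distinct eigenvalues. (2) Consequently, for every finite multiset of non-empty tuples of positive even numbers and every finite multiset of odd positive integers containing $3$, there is a complex finite-dimensional Lie algebra whose JK invariants are these Jordan tuples and these Kronecker sizes. -/

import Mathlib

/-! ### Pencils of skew-symmetric forms and their blocks -/

/-- A block of the Jordan--Kronecker normal form of a pair of skew-symmetric forms:
`jordan μ n` is the Jordan `2n × 2n` block with eigenvalue `μ ∈ ℂ ∪ {∞}`, and
`kronecker m` is the Kronecker `(2m+1) × (2m+1)` block. -/
inductive JKBlock : Type
  | jordan (μ : OnePoint ℂ) (n : ℕ)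
  | kronecker (m : ℕ)

namespace JKBlock

/-- The index set of the standard basis of a block. -/
def Idx : JKBlock → Type
  | jordan _ n => Fin n ⊕ Fin n
  | kronecker m => Fin m ⊕ Fin (m + 1)

/-- The upper triangular `n × n` Jordan cell. -/
def cell (n : ℕ) (c : ℂ) : Matrix (Fin n) (Fin n) ℂ :=
  Matrix.of fun i j => if i = j then c else if i.val + 1 = j.val then 1 else 0

/-- The `m × (m+1)` matrix `(I_m 0)`. -/
def leftShift (m : ℕ) : Matrix (Fin m) (Fin (m + 1)) ℂ :=
  Matrix.of fun i j => if i.val = j.val then 1 else 0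

/-- The `m × (m+1)` matrix `(0 I_m)`. -/
def rightShift (m : ℕ) : Matrix (Fin m) (Fin (m + 1)) ℂ :=
  Matrix.of fun i j => if i.val + 1 = j.val then 1 else 0

/-- The skew-symmetric matrix with off-diagonal blocks `Q` and `-Qᵀ`. -/
def skew {m k : Type} (Q : Matrix m k ℂ) : Matrix (m ⊕ k) (m ⊕ k) ℂ :=
  Matrix.fromBlocks 0 Q (-Q.transpose) 0

/-- The matrix of the first form in a block. -/
def matA : (B : JKBlock) → Matrix B.Idx B.Idx ℂ
  | jordan (OnePoint.some c) n => skew (cell n c)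
  | jordan OnePoint.infty n => skew (1 : Matrix (Fin n) (Fin n) ℂ)
  | kronecker m => skew (leftShift m)

/-- The matrix of the second form in a block. -/
def matB : (B : JKBlock) → Matrix B.Idx B.Idx ℂ
  | jordan (OnePoint.some _) n => skew (1 : Matrix (Fin n) (Fin n) ℂ)
  | jordan OnePoint.infty n => skew (cell n 0)
  | kronecker m => skew (rightShift m)

/-- Blocks have positive size. -/
def IsProper : JKBlock → Prop
  | jordan _ n => 0 < n
  | kronecker _ => True

/-- The size `2m+1` of a Kronecker block. -/
def kroneckerSize? : JKBlock → Option ℕ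
  | jordan _ _ => none
  | kronecker m => some (2 * m + 1)

/-- The eigenvalue of a Jordan block. -/
def eigenvalue? : JKBlock → Option (OnePoint ℂ)
  | jordan μ _ => some μ
  | kronecker _ => none

open Classical in
/-- The size `2n` of a Jordan block, if its eigenvalue is `μ`. -/
noncomputable def jordanSize? (μ : OnePoint ℂ) : JKBlock → Option ℕ
  | jordan ν n => if ν = μ then some (2 * n) else none
  | kronecker _ => none

end JKBlock

/-! ### Algebraic types -/

/-- The algebraic type of a pencil of skew-symmetric forms: the multiset of Jordan tuples (a tuple
sorted in descending order is the same thing as a multiset of block sizes), one for each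
eigenvalue, and the multiset of Kronecker sizes. -/
@[ext]
structure JKType : Type where
  jordan : Multiset (Multiset ℕ)
  kronecker : Multiset ℕ

/-- The types which occur formally: each Jordan tuple is a nonempty tuple of positive even
numbers, and Kronecker sizes are odd. -/
def JKType.IsAdmissible (T : JKType) : Prop :=
  (∀ J ∈ T.jordan, J ≠ 0 ∧ ∀ d ∈ J, 0 < d ∧ Even d) ∧ ∀ d ∈ T.kronecker, Odd d

open Classical in
/-- The algebraic type of a collection of blocks: sizes of Kronecker blocks, and sizes of Jordan
blocks grouped by eigenvalue. -/
noncomputable def JKType.ofBlocks (S : Multiset JKBlock) : JKType where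
  jordan := (S.filterMap JKBlock.eigenvalue?).toFinset.val.map
    fun μ => S.filterMap (JKBlock.jordanSize? μ)
  kronecker := S.filterMap JKBlock.kroneckerSize?

/-- The pencil `A + λ B` on `V` has algebraic type `T`: in some basis the matrices of both forms
are block-diagonal with standard blocks, and the blocks have type `T`. -/
def HasAlgebraicType {V : Type*} [AddCommGroup V] [Module ℂ V]
    (A B : LinearMap.BilinForm ℂ V) (T : JKType) : Prop :=
  ∃ (ι : Type) (_ : Fintype ι) (_ : DecidableEq ι) (blk : ι → JKBlock)
    (b : Module.Basis (Σ i, (blk i).Idx) ℂ V),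
    (∀ i, (blk i).IsProper) ∧
    (∀ r s, A (b r) (b s) = Matrix.blockDiagonal' (fun i => (blk i).matA) r s) ∧
    (∀ r s, B (b r) (b s) = Matrix.blockDiagonal' (fun i => (blk i).matB) r s) ∧
    JKType.ofBlocks (Finset.univ.val.map blk) = T

/-! ### Jordan--Kronecker invariants of Lie algebras -/

/-- The skew-symmetric form `𝒜_x(u, v) = ⟨x, [u, v]⟩` on `L`, for `x ∈ L*`. -/
def lieForm {L : Type*} [LieRing L] [LieAlgebra ℂ L] (x : Module.Dual ℂ L) :
    LinearMap.BilinForm ℂ L :=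
  LinearMap.mk₂ ℂ (fun u v => x ⁅u, v⁆) (by simp) (by simp) (by simp) (by simp)

/-- Zariski open subsets of a vector space: the complements of the zero sets of collections of
polynomials in linear functionals. -/
def IsZariskiOpen {W : Type*} [AddCommGroup W] [Module ℂ W] (U : Set W) : Prop :=
  ∃ S : Set (MvPolynomial (Module.Dual ℂ W) ℂ),
    U = {w | ∃ P ∈ S, MvPolynomial.eval (fun φ : Module.Dual ℂ W => φ w) P ≠ 0}

/-- The Jordan--Kronecker invariants of `L` are given by `T`: for all pairs `(x, a)` in a nonempty
Zariski open subset of `L* × L*`, the pencil `𝒜_x + λ 𝒜_a` has algebraic type `T`. -/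
def HasJKInvariants (L : Type*) [LieRing L] [LieAlgebra ℂ L] (T : JKType) : Prop :=
  ∃ U : Set (Module.Dual ℂ L × Module.Dual ℂ L), IsZariskiOpen U ∧ U.Nonempty ∧
    ∀ q ∈ U, HasAlgebraicType (lieForm q.1) (lieForm q.2) T

/-! ### The Lie algebra of one Kronecker `3 × 3` block and several Jordan tuples -/

/-- The index set of the basis `g, h₁, h₂, e^i_{tj}, f^i_{tj}`. The indices `t, i, j` are counted
from `0` here, so that `e t i j` stands for `e^{i+1}_{t+1, j+1}`. -/
inductive Kron3Idx {N : ℕ} (p : Fin N → ℕ) (n : (t : Fin N) → Fin (p t) → ℕ) : Type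
  | g
  | h₁
  | h₂
  | e (t : Fin N) (i : Fin (p t)) (j : Fin (n t i))
  | f (t : Fin N) (i : Fin (p t)) (j : Fin (n t i))

/-- The commutation relations of the basis `g, h₁, h₂, e^i_{tj}, f^i_{tj}`: the nonzero ones are in
the first five fields, all other brackets of basis vectors vanish. -/
structure Kron3Relations {N : ℕ} {p : Fin N → ℕ} {n : (t : Fin N) → Fin (p t) → ℕ}
    (α β : Fin N → ℂ) {L : Type*} [LieRing L] [LieAlgebra ℂ L]
    (b : Module.Basis (Kron3Idx p n) ℂ L) : Prop where
  g_h₁ : ⁅b .g, b .h₁⁆ = b .h₁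
  g_h₂ : ⁅b .g, b .h₂⁆ = b .h₂
  g_e : ∀ t i j, ⁅b .g, b (.e t i j)⁆ = b (.e t i j)
  /-- With indices counted from `1`, this is `[e_j, f_k] = e_{j-k}` for `j > k`. -/
  e_f_gt : ∀ t i (j k : Fin (n t i)), k < j →
    ⁅b (.e t i j), b (.f t i k)⁆ = b (.e t i ⟨j.val - k.val - 1, by omega⟩)
  e_f_eq : ∀ t i (j : Fin (n t i)),
    ⁅b (.e t i j), b (.f t i j)⁆ = α t • b .h₁ + β t • b .h₂
  e_f_lt : ∀ t i (j k : Fin (n t i)), j < k → ⁅b (.e t i j), b (.f t i k)⁆ = 0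
  e_f_ne : ∀ t i j s l k, (⟨t, i⟩ : Σ t, Fin (p t)) ≠ ⟨s, l⟩ →
    ⁅b (.e t i j), b (.f s l k)⁆ = 0
  g_f : ∀ t i j, ⁅b .g, b (.f t i j)⁆ = 0
  h_h : ⁅b .h₁, b .h₂⁆ = 0
  h₁_e : ∀ t i j, ⁅b .h₁, b (.e t i j)⁆ = 0
  h₁_f : ∀ t i j, ⁅b .h₁, b (.f t i j)⁆ = 0
  h₂_e : ∀ t i j, ⁅b .h₂, b (.e t i j)⁆ = 0
  h₂_f : ∀ t i j, ⁅b .h₂, b (.f t i j)⁆ = 0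
  e_e : ∀ t i j s l k, ⁅b (.e t i j), b (.e s l k)⁆ = 0
  f_f : ∀ t i j s l k, ⁅b (.f t i j), b (.f s l k)⁆ = 0

/-- One Kronecker `3 × 3` block and the Jordan tuples `(2n_{t1}, …, 2n_{tp_t})`. -/
def kron3Type {N : ℕ} (p : Fin N → ℕ) (n : (t : Fin N) → Fin (p t) → ℕ) : JKType where
  jordan := (Finset.univ : Finset (Fin N)).val.map
    fun t => (Finset.univ : Finset (Fin (p t))).val.map fun i => 2 * n t i
  kronecker := {3}

/-! The algebra in (1) is a semidirect product: the commuting elements `g`, `f^i_{tj}` act on the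
abelian ideal spanned by `h₁`, `h₂`, `e^i_{tj}`. Here `g` acts as the identity, and `f^i_{tk}`
lowers the chain `α_t h₁ + β_t h₂, e^i_{t1}, e^i_{t2}, …` by `k` steps, up to sign. These operators
commute, so the algebra exists (`exists_kron3Relations`).

For generic `(x, a)` the functionals `x` and `a` are independent on the span of `h₁, h₂`. Take there
the basis dual to them, and subtract from each `e^i_{tj}` the combination of `h₁, h₂` that puts it
in `ker x ∩ ker a`. Since `h₁, h₂` commute with everything except `g`, the brackets of the `e`'s
with the `f`'s do not change, while `g` becomes orthogonal to the new `e`'s for both forms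
(`Kron3Relations.lieForm_eq`). The triple `g, h₁, h₂` is then a standard Kronecker `3 × 3` block,
and each `(t, i)` gives a pair of lower triangular Toeplitz matrices. Generically such a pair is
equivalent to one Jordan cell and the identity (`exists_lowerToeplitz_normalForm`). The eigenvalue
is the ratio of the values of `x` and `a` on `α_t h₁ + β_t h₂`. It depends on `t` only, and
non-proportionality of the `(α_t, β_t)` makes the eigenvalues distinct.

For (2), multiply such an algebra, which supplies the size `3`, by algebras with a single Kronecker
block. A suitable one is an abelian algebra of dimension `m` acting diagonally on `ℂ^{m+1}`
(`exists_hasJKInvariants_kronecker`). Pencils of products are orthogonal sums, so the types add up.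
-/

/-! ### Matrices -/

section Matrices

open Matrix

/-! ### Pairs of Toeplitz matrices and Jordan blocks. -/

/-- The lower triangular `n × n` Toeplitz matrix with entries `c (i - j)`. -/
def lowerToeplitz (n : ℕ) (c : ℕ → ℂ) : Matrix (Fin n) (Fin n) ℂ :=
  Matrix.of fun i j => if j ≤ i then c (i.val - j.val) else 0

theorem isUnit_det_lowerToeplitz {n : ℕ} {c : ℕ → ℂ} (h : c 0 ≠ 0) :
    IsUnit (lowerToeplitz n c).det := by
  rw [Matrix.det_of_isLowerTriangular]
  · simp [lowerToeplitz, h]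
  · intro i j hij
    have : i < j := hij
    simp [lowerToeplitz, this.not_ge]

/-- Powers of a strictly lower triangular matrix vanish above the corresponding subdiagonal. -/
theorem pow_apply_eq_zero_of_strictLower {n : ℕ} {D : Matrix (Fin n) (Fin n) ℂ}
    (h0 : ∀ i j, i ≤ j → D i j = 0) (r : ℕ) :
    ∀ a b : Fin n, a.val < b.val + r → (D ^ r) a b = 0 := by
  induction r with
  | zero =>
    intro a b hab
    rw [pow_zero, Matrix.one_apply_ne]
    rintro rfl
    omega
  | succ r ih =>
    intro a b hab
    rw [pow_succ, Matrix.mul_apply]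
    refine Finset.sum_eq_zero fun c _ => ?_
    by_cases hc : c ≤ b
    · rw [h0 c b hc, mul_zero]
    · rw [ih a c, zero_mul]
      rw [Fin.le_def] at hc
      omega

/-- On the `r`-th subdiagonal of `D ^ r` only one product survives, that of `r` consecutive
subdiagonal entries of `D`. -/
theorem pow_apply_ne_zero_of_strictLower {n : ℕ} {D : Matrix (Fin n) (Fin n) ℂ}
    (h0 : ∀ i j, i ≤ j → D i j = 0) (h1 : ∀ i j : Fin n, i.val = j.val + 1 → D i j ≠ 0) (r : ℕ) :
    ∀ a b : Fin n, a.val = b.val + r → (D ^ r) a b ≠ 0 := by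
  induction r with
  | zero =>
    intro a b hab
    have : a = b := Fin.ext hab
    simp [this]
  | succ r ih =>
    intro a b hab
    have hb : b.val + 1 < n := by omega
    rw [pow_succ, Matrix.mul_apply, Finset.sum_eq_single ⟨b.val + 1, hb⟩]
    · exact mul_ne_zero (ih _ _ (by simp; omega)) (h1 _ _ rfl)
    · intro c _ hc
      by_cases hcb : c ≤ b
      · rw [h0 c b hcb, mul_zero]
      · rw [pow_apply_eq_zero_of_strictLower h0, zero_mul]
        rw [Fin.le_def] at hcb
        have : c.val ≠ b.val + 1 := fun h => hc (Fin.ext h)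
        omega
    · simp

/-- A strictly lower triangular matrix with nonzero subdiagonal is similar to the nilpotent
Jordan cell. -/
theorem exists_similar_cell_of_strictLower {n : ℕ} (hn : 0 < n) {D : Matrix (Fin n) (Fin n) ℂ}
    (h0 : ∀ i j, i ≤ j → D i j = 0) (h1 : ∀ i j : Fin n, i.val = j.val + 1 → D i j ≠ 0) :
    ∃ S : Matrix (Fin n) (Fin n) ℂ, IsUnit S ∧ S * D = JKBlock.cell n 0 * S := by
  let l : Fin n := ⟨n - 1, by omega⟩
  -- The last basis row vector is cyclic for `D`: the rows of `S` are its images under the powers of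
  -- `D`, so right multiplication by `D` shifts the rows, as does left multiplication by the cell.
  -- With columns reversed, `S` is upper triangular with nonzero diagonal.
  let S : Matrix (Fin n) (Fin n) ℂ := Matrix.of fun i k => (D ^ i.val) l k
  refine ⟨S, ?_, ?_⟩
  · rw [← Matrix.isUnit_submatrix_equiv (Equiv.refl _) Fin.revPerm, Matrix.isUnit_iff_isUnit_det,
      Matrix.det_of_isUpperTriangular]
    · refine (Finset.prod_ne_zero_iff.2 fun i _ => ?_).isUnit
      exact pow_apply_ne_zero_of_strictLower h0 h1 _ _ _ (by simp [l]; omega)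
    · intro i j hij
      have hij : j < i := hij
      exact pow_apply_eq_zero_of_strictLower h0 _ _ _ (by simp [l]; omega)
  · ext i k
    have hL : (S * D) i k = (D ^ (i.val + 1)) l k := by
      rw [pow_succ, Matrix.mul_apply, Matrix.mul_apply]; rfl
    rw [hL, Matrix.mul_apply]
    by_cases hi : i.val + 1 < n
    · rw [Finset.sum_eq_single ⟨i.val + 1, hi⟩]
      · simp [JKBlock.cell, S, Fin.ext_iff]
      · intro j _ hj
        have : i.val + 1 ≠ j.val := fun h => hj (Fin.ext h.symm)
        simp [JKBlock.cell, this]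
      · simp
    · rw [pow_apply_eq_zero_of_strictLower h0 _ _ _ (by simp [l]; omega), Finset.sum_eq_zero]
      intro j _
      have : i.val + 1 ≠ j.val := by omega
      simp [JKBlock.cell, this]

theorem cell_eq_add (n : ℕ) (c : ℂ) :
    JKBlock.cell n c = JKBlock.cell n 0 + c • (1 : Matrix (Fin n) (Fin n) ℂ) := by
  ext i j
  by_cases h : i = j <;> simp [JKBlock.cell, h]

/-- A generic pair of lower triangular Toeplitz matrices is equivalent to a Jordan cell and the
identity matrix. -/
theorem exists_lowerToeplitz_normalForm {n : ℕ} (hn : 0 < n) {X Y : ℕ → ℂ} (hY : Y 0 ≠ 0)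
    (hXY : 1 < n → X 1 * Y 0 - X 0 * Y 1 ≠ 0) :
    ∃ P R : Matrix (Fin n) (Fin n) ℂ, IsUnit P ∧ IsUnit R ∧
      P * lowerToeplitz n X * R = JKBlock.cell n (X 0 / Y 0) ∧ P * lowerToeplitz n Y * R = 1 := by
  set MB := lowerToeplitz n Y with hMB
  have hdet : IsUnit MB.det := isUnit_det_lowerToeplitz hY
  have : Invertible MB := MB.invertibleOfIsUnitDet hdet
  -- Subtracting the eigenvalue times the second matrix leaves a strictly lower triangular matrix.
  -- Its subdiagonal entries all equal `(X 1 * Y 0 - X 0 * Y 1) / Y 0`.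
  set E := lowerToeplitz n X - (X 0 / Y 0) • MB with hE
  have hlow : MB.BlockTriangular OrderDual.toDual := by
    intro i j hij
    have : i < j := hij
    simp [hMB, lowerToeplitz, this.not_ge]
  have hinv : MB⁻¹.BlockTriangular OrderDual.toDual :=
    Matrix.blockTriangular_inv_of_blockTriangular hlow
  have hinv0 : ∀ i j, i < j → MB⁻¹ i j = 0 := fun i j hij => hinv hij
  have hinvd : ∀ i, MB⁻¹ i i ≠ 0 := by
    have h : MB⁻¹.det ≠ 0 := (Matrix.isUnit_nonsing_inv_det MB hdet).ne_zero
    rw [Matrix.det_of_isLowerTriangular _ hinv, Finset.prod_ne_zero_iff] at h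
    exact fun i => h i (Finset.mem_univ i)
  have hE0 : ∀ i j, i ≤ j → E i j = 0 := by
    intro i j hij
    rcases hij.eq_or_lt with rfl | h
    · simp [hE, hMB, lowerToeplitz, hY]
    · simp [hE, hMB, lowerToeplitz, h.not_ge]
  have hE1 : ∀ i j : Fin n, i.val = j.val + 1 → E i j ≠ 0 := by
    intro i j hij
    have hji : j ≤ i := by rw [Fin.le_def]; omega
    have h1 : i.val - j.val = 1 := by omega
    have hX := hXY (by omega)
    have : E i j = (X 1 * Y 0 - X 0 * Y 1) / Y 0 := by
      simp [hE, hMB, lowerToeplitz, hji, h1]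
      field_simp
    rw [this]
    exact div_ne_zero hX hY
  -- Multiplying by the lower triangular `MB⁻¹` keeps `E` strictly lower triangular and only
  -- rescales its subdiagonal by nonzero factors.
  obtain ⟨S, hS, hSD⟩ := exists_similar_cell_of_strictLower hn (D := E * MB⁻¹)
    (fun i j hij => by
      rw [Matrix.mul_apply]
      refine Finset.sum_eq_zero fun k _ => ?_
      rcases le_or_gt i k with h | h
      · rw [hE0 i k h, zero_mul]
      · rw [hinv0 k j (h.trans_le hij), mul_zero])
    (fun i j hij => by
      rw [Matrix.mul_apply, Finset.sum_eq_single j]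
      · exact mul_ne_zero (hE1 i j hij) (hinvd j)
      · intro k _ hk
        rcases lt_or_gt_of_ne hk with h | h
        · rw [hinv0 k j h, mul_zero]
        · rw [hE0 i k (by rw [Fin.le_def]; rw [Fin.lt_def] at h; omega), zero_mul]
      · simp)
  have hSdet : IsUnit S.det := (Matrix.isUnit_iff_isUnit_det S).1 hS
  have hone : S * MB * (MB⁻¹ * S⁻¹) = 1 := by
    rw [Matrix.mul_assoc, ← Matrix.mul_assoc MB, Matrix.mul_nonsing_inv _ hdet, Matrix.one_mul,
      Matrix.mul_nonsing_inv _ hSdet]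
  refine ⟨S, MB⁻¹ * S⁻¹, hS, ?_, ?_, hone⟩
  · rw [Matrix.isUnit_iff_isUnit_det, Matrix.det_mul]
    exact (Matrix.isUnit_nonsing_inv_det _ hdet).mul (Matrix.isUnit_nonsing_inv_det _ hSdet)
  · have hX : lowerToeplitz n X = E + (X 0 / Y 0) • MB := by simp [hE]
    have hcell : S * E * (MB⁻¹ * S⁻¹) = JKBlock.cell n 0 := by
      rw [Matrix.mul_assoc, ← Matrix.mul_assoc E, ← Matrix.mul_assoc, hSD, Matrix.mul_assoc,
        Matrix.mul_nonsing_inv _ hSdet, Matrix.mul_one]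
    rw [hX, Matrix.mul_add, Matrix.add_mul, hcell, Matrix.mul_smul, Matrix.smul_mul, hone,
      cell_eq_add n (X 0 / Y 0)]

/-! ### Pairs of star matrices and Kronecker blocks. -/

/-- The `m × (m+1)` matrix with rows `x_{i+1} δ_{i+1} - x_0 δ_0`. -/
def starMatrix (m : ℕ) (x : Fin (m + 1) → ℂ) : Matrix (Fin m) (Fin (m + 1)) ℂ :=
  Matrix.of fun i => Fin.cons (-x 0) fun j => if i = j then x i.succ else 0

/-- There are `m` equations in `m + 1` unknowns, so a nonzero solution exists. If one coordinate
vanished, the others would solve a square Vandermonde system with distinct nodes and vanish too. -/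
theorem exists_sum_pow_eq_zero {m : ℕ} {r : Fin (m + 1) → ℂ} (hr : Function.Injective r) :
    ∃ y : Fin (m + 1) → ℂ, (∀ j, y j ≠ 0) ∧ ∀ k < m, ∑ j, r j ^ k * y j = 0 := by
  let V : Matrix (Fin m) (Fin (m + 1)) ℂ := Matrix.of fun k j => r j ^ k.val
  obtain ⟨y, hy, hy0⟩ : ∃ y, V.mulVecLin y = 0 ∧ y ≠ 0 := by
    exact (Submodule.ne_bot_iff _).1 (V.mulVecLin.ker_ne_bot_of_finrank_lt (by simp))
  have hsum : ∀ k < m, ∑ j, r j ^ k * y j = 0 := fun k hk => congrFun hy ⟨k, hk⟩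
  refine ⟨y, fun i hi => hy0 ?_, hsum⟩
  have h0 : (fun j => y (i.succAbove j)) = 0 := by
    refine Matrix.eq_zero_of_forall_pow_sum_mul_pow_eq_zero (f := fun j => r (i.succAbove j))
      (hr.comp Fin.succAbove_right_injective) fun k => ?_
    have := hsum k.val k.isLt
    rw [Fin.sum_univ_succAbove _ i, hi, mul_zero, zero_add] at this
    simpa [mul_comm] using this
  ext j
  rcases eq_or_ne j i with rfl | h
  · exact hi
  · obtain ⟨k, rfl⟩ := Fin.exists_succAbove_eq h
    exact congrFun h0 k

/-- A generic pair of star matrices is equivalent to the standard Kronecker pair. -/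
theorem exists_starMatrix_normalForm {m : ℕ} {x a : Fin (m + 1) → ℂ} (hx : ∀ j, x j ≠ 0)
    (hr : Function.Injective fun j => a j / x j) :
    ∃ (P : Matrix (Fin m) (Fin m) ℂ) (R : Matrix (Fin (m + 1)) (Fin (m + 1)) ℂ),
      IsUnit P ∧ IsUnit R ∧ P * starMatrix m x * R = JKBlock.leftShift m ∧
      P * starMatrix m a * R = JKBlock.rightShift m := by
  obtain ⟨y, hy, hsum⟩ := exists_sum_pow_eq_zero hr
  set r : Fin (m + 1) → ℂ := fun j => a j / x j with hrdef
  have ha : ∀ j, a j = r j * x j := fun j => by simp [hrdef, hx j]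
  let P : Matrix (Fin m) (Fin m) ℂ := Matrix.of fun k i => r i.succ ^ k.val * y i.succ
  let Z : Matrix (Fin (m + 1)) (Fin (m + 1)) ℂ := Matrix.of fun k j => r j ^ k.val * (y j * x j)
  have hP : IsUnit P := by
    have : P = (vandermonde fun i => r i.succ)ᵀ * diagonal fun i => y i.succ := by
      ext k i; simp [P, vandermonde_apply]
    rw [this, Matrix.isUnit_iff_isUnit_det, det_mul, det_transpose, det_diagonal]
    refine (mul_ne_zero ?_ (Finset.prod_ne_zero_iff.2 fun i _ => hy _)).isUnit
    exact det_vandermonde_ne_zero_iff.2 (hr.comp (Fin.succ_injective m))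
  have hZ : IsUnit Z.det := by
    have : Z = (vandermonde r)ᵀ * diagonal fun j => y j * x j := by
      ext k i; simp [Z, vandermonde_apply]
    rw [this, det_mul, det_transpose, det_diagonal]
    refine (mul_ne_zero ?_ (Finset.prod_ne_zero_iff.2 fun i _ => mul_ne_zero (hy _) (hx _))).isUnit
    exact det_vandermonde_ne_zero_iff.2 hr
  -- The relations satisfied by `y` make column `0` obey the same formula as the others. As `a j = r
  -- j * x j`, row `k` of the product is row `k` of `Z` for `z = x` and row `k + 1` for `z = a`,
  -- which is the Kronecker pair of shifts.
  have hPz : ∀ (z : Fin (m + 1) → ℂ) (k : Fin m) (j : Fin (m + 1)),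
      (P * starMatrix m z) k j = r j ^ k.val * y j * z j := by
    intro z k j
    rw [Matrix.mul_apply]
    refine Fin.cases ?_ (fun j => ?_) j
    · have h := hsum k.val k.isLt
      rw [Fin.sum_univ_succ] at h
      simp only [starMatrix, Matrix.of_apply, Fin.cons_zero, P, ← Finset.sum_mul]
      linear_combination -z 0 * h
    · simp [starMatrix, P]
  have hL : P * starMatrix m x = JKBlock.leftShift m * Z := by
    ext k j
    rw [hPz, Matrix.mul_apply, Finset.sum_eq_single k.castSucc]
    · simp [JKBlock.leftShift, Z, mul_assoc]
    · intro l _ hl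
      have : k.val ≠ l.val := fun h => hl (Fin.ext h.symm)
      simp [JKBlock.leftShift, this]
    · simp
  have hR : P * starMatrix m a = JKBlock.rightShift m * Z := by
    ext k j
    rw [hPz, Matrix.mul_apply, Finset.sum_eq_single k.succ]
    · simp [JKBlock.rightShift, Z, ha j]
      ring
    · intro l _ hl
      have : k.val + 1 ≠ l.val := fun h => hl (Fin.ext h.symm)
      simp [JKBlock.rightShift, this]
    · simp
  refine ⟨P, Z⁻¹, hP, (Matrix.isUnit_iff_isUnit_det _).2 (Matrix.isUnit_nonsing_inv_det _ hZ),
    ?_, ?_⟩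
  · rw [hL, Matrix.mul_assoc, Matrix.mul_nonsing_inv _ hZ, Matrix.mul_one]
  · rw [hR, Matrix.mul_assoc, Matrix.mul_nonsing_inv _ hZ, Matrix.mul_one]

/-- Equivalent off-diagonal blocks give congruent skew-symmetric matrices. -/
theorem fromBlocks_transpose_mul_skew_mul {m k : Type} [Fintype m] [Fintype k]
    (Q P : Matrix m k ℂ) (S : Matrix m m ℂ) (R : Matrix k k ℂ) (h : S * Q * R = P) :
    (fromBlocks Sᵀ 0 0 R)ᵀ * JKBlock.skew Q * fromBlocks Sᵀ 0 0 R = JKBlock.skew P := by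
  subst h
  simp [JKBlock.skew, fromBlocks_transpose, fromBlocks_multiply, Matrix.mul_assoc]

theorem isUnit_fromBlocks_transpose {m k : Type} [Fintype m] [Fintype k] [DecidableEq m]
    [DecidableEq k] {S : Matrix m m ℂ} {R : Matrix k k ℂ} (hS : IsUnit S) (hR : IsUnit R) :
    IsUnit (fromBlocks Sᵀ 0 0 R) := by
  rw [Matrix.isUnit_fromBlocks_zero₂₁]
  exact ⟨(Matrix.isUnit_transpose S).2 hS, hR⟩

end Matrices

/-! ### Algebraic types of pencils -/

namespace JKBlock

instance instFintypeIdx : (B : JKBlock) → Fintype B.Idx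
  | jordan _ n => inferInstanceAs (Fintype (Fin n ⊕ Fin n))
  | kronecker m => inferInstanceAs (Fintype (Fin m ⊕ Fin (m + 1)))

instance instDecidableEqIdx : (B : JKBlock) → DecidableEq B.Idx
  | jordan _ n => inferInstanceAs (DecidableEq (Fin n ⊕ Fin n))
  | kronecker m => inferInstanceAs (DecidableEq (Fin m ⊕ Fin (m + 1)))

end JKBlock

/-- A pair of forms whose matrices are block-diagonal, with each pair of blocks congruent to a
standard one, has the algebraic type of these standard blocks. -/
theorem HasAlgebraicType.of_congruent_blocks {V : Type*} [AddCommGroup V] [Module ℂ V]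
    {A B : LinearMap.BilinForm ℂ V} {ι : Type} [Fintype ι] [DecidableEq ι] {blk : ι → JKBlock}
    (hp : ∀ i, (blk i).IsProper) (b : Module.Basis (Σ i, (blk i).Idx) ℂ V)
    (NA NB M : ∀ i, Matrix (blk i).Idx (blk i).Idx ℂ)
    (hA : ∀ r s, A (b r) (b s) = Matrix.blockDiagonal' NA r s)
    (hB : ∀ r s, B (b r) (b s) = Matrix.blockDiagonal' NB r s)
    (hM : ∀ i, IsUnit (M i))
    (hMA : ∀ i, (M i).transpose * NA i * M i = (blk i).matA)
    (hMB : ∀ i, (M i).transpose * NB i * M i = (blk i).matB) :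
    HasAlgebraicType A B (JKType.ofBlocks (Finset.univ.val.map blk)) := by
  have hdet : IsUnit (Matrix.blockDiagonal' M).det := by
    rw [← Matrix.isUnit_iff_isUnit_det]
    exact (Pi.isUnit_iff.2 hM).map (Matrix.blockDiagonal'RingHom (fun i => (blk i).Idx) ℂ)
  let c := b.map (Matrix.toLinearEquiv b (Matrix.blockDiagonal' M) hdet)
  have hc : b.toMatrix c = Matrix.blockDiagonal' M := by
    ext i j
    simp [c, Module.Basis.toMatrix_apply, Matrix.toLinearEquiv, Matrix.toLin_self,
      Finsupp.single_apply]
  have key : ∀ (F : LinearMap.BilinForm ℂ V) (N N' : ∀ i, Matrix (blk i).Idx (blk i).Idx ℂ),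
      (∀ r s, F (b r) (b s) = Matrix.blockDiagonal' N r s) →
      (∀ i, (M i).transpose * N i * M i = N' i) →
      ∀ r s, F (c r) (c s) = Matrix.blockDiagonal' N' r s := by
    intro F N N' hF hN r s
    have hFb : LinearMap.BilinForm.toMatrix b F = Matrix.blockDiagonal' N := by
      ext i j
      rw [LinearMap.BilinForm.toMatrix_apply, hF]
    rw [← LinearMap.BilinForm.toMatrix_apply, ← LinearMap.BilinForm.toMatrix_mul_basis_toMatrix b,
      hFb, hc, Matrix.blockDiagonal'_transpose, ← Matrix.blockDiagonal'_mul,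
      ← Matrix.blockDiagonal'_mul, funext hN]
  exact ⟨ι, inferInstance, inferInstance, blk, c, hp, key A NA _ hA hMA, key B NB _ hB hMB, rfl⟩

/-- Adding blocks without Jordan blocks among them only adds Kronecker sizes. -/
theorem JKType.ofBlocks_add_kronecker (S K : Multiset JKBlock)
    (hK : ∀ B ∈ K, ∃ m, B = JKBlock.kronecker m) :
    JKType.ofBlocks (S + K) =
      ⟨(JKType.ofBlocks S).jordan, (JKType.ofBlocks S).kronecker + (JKType.ofBlocks K).kronecker⟩ := by
  have h1 : K.filterMap JKBlock.eigenvalue? = 0 := by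
    rw [Multiset.eq_zero_iff_forall_notMem]
    intro μ hμ
    obtain ⟨B, hB, h⟩ := (Multiset.mem_filterMap _ _).1 hμ
    obtain ⟨m, rfl⟩ := hK B hB
    simp [JKBlock.eigenvalue?] at h
  have h2 : ∀ μ, K.filterMap (JKBlock.jordanSize? μ) = 0 := by
    intro μ
    rw [Multiset.eq_zero_iff_forall_notMem]
    intro d hd
    obtain ⟨B, hB, h⟩ := (Multiset.mem_filterMap _ _).1 hd
    obtain ⟨m, rfl⟩ := hK B hB
    simp [JKBlock.jordanSize?] at h
  simp [JKType.ofBlocks, Multiset.filterMap_add, h1, h2]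

/-- The orthogonal sum of two pencils, one of which has Kronecker blocks only. -/
theorem HasAlgebraicType.prod_kronecker {V W : Type*} [AddCommGroup V] [Module ℂ V]
    [AddCommGroup W] [Module ℂ W] {A B : LinearMap.BilinForm ℂ V} {A' B' : LinearMap.BilinForm ℂ W}
    {F G : LinearMap.BilinForm ℂ (V × W)} {T T' : JKType}
    (h : HasAlgebraicType A B T) (h' : HasAlgebraicType A' B' T') (hT' : T'.jordan = 0)
    (hF : ∀ u v, F u v = A u.1 v.1 + A' u.2 v.2) (hG : ∀ u v, G u v = B u.1 v.1 + B' u.2 v.2) :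
    HasAlgebraicType F G ⟨T.jordan, T.kronecker + T'.kronecker⟩ := by
  obtain ⟨ι, hι, hι', blk, b, hp, hA, hB, rfl⟩ := h
  obtain ⟨κ, hκ, hκ', blk', b', hp', hA', hB', rfl⟩ := h'
  -- A Jordan block would contribute its eigenvalue, and hence a tuple, to the type.
  have hK : ∀ C ∈ (Finset.univ.val.map blk'), ∃ m, C = JKBlock.kronecker m := by
    intro C hC
    cases C with
    | kronecker m => exact ⟨m, rfl⟩
    | jordan μ n =>
      exfalso
      simp only [JKType.ofBlocks, Multiset.map_eq_zero, Finset.val_eq_zero] at hT'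
      have : μ ∈ ((Finset.univ.val.map blk').filterMap JKBlock.eigenvalue?) :=
        (Multiset.mem_filterMap _ _).2 ⟨_, hC, rfl⟩
      classical
      rw [← Multiset.mem_toFinset] at this
      exact Finset.ne_empty_of_mem this (by convert hT')
  let e := Equiv.sumSigmaDistrib fun i : ι ⊕ κ => (Sum.elim blk blk' i).Idx
  let c : Module.Basis (Σ i : ι ⊕ κ, (Sum.elim blk blk' i).Idx) ℂ (V × W) :=
    (b.prod b').reindex e.symm
  have hcl : ∀ i (r : (blk i).Idx), c ⟨Sum.inl i, r⟩ = (b ⟨i, r⟩, 0) := fun i r =>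
    ((b.prod b').reindex_apply e.symm _).trans <|
      Prod.ext (Module.Basis.prod_apply_inl_fst b b' _) (Module.Basis.prod_apply_inl_snd b b' _)
  have hcr : ∀ i (r : (blk' i).Idx), c ⟨Sum.inr i, r⟩ = (0, b' ⟨i, r⟩) := fun i r =>
    ((b.prod b').reindex_apply e.symm _).trans <|
      Prod.ext (Module.Basis.prod_apply_inr_fst b b' _) (Module.Basis.prod_apply_inr_snd b b' _)
  have key : ∀ (N : ∀ C : JKBlock, Matrix C.Idx C.Idx ℂ) (A : LinearMap.BilinForm ℂ V)
      (A' : LinearMap.BilinForm ℂ W) (F : LinearMap.BilinForm ℂ (V × W)),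
      (∀ r s, A (b r) (b s) = Matrix.blockDiagonal' (fun i => N (blk i)) r s) →
      (∀ r s, A' (b' r) (b' s) = Matrix.blockDiagonal' (fun i => N (blk' i)) r s) →
      (∀ u v, F u v = A u.1 v.1 + A' u.2 v.2) → ∀ r s, F (c r) (c s) =
        Matrix.blockDiagonal' (fun i => N (Sum.elim blk blk' i)) r s := by
    intro N A A' F hA hA' hF
    have hll : ∀ i j (r : (blk i).Idx) (s : (blk j).Idx), F (c ⟨Sum.inl i, r⟩) (c ⟨Sum.inl j, s⟩) =
        Matrix.blockDiagonal' (fun i => N (Sum.elim blk blk' i)) ⟨Sum.inl i, r⟩ ⟨Sum.inl j, s⟩ := by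
      intro i j r s
      rw [hcl, hcl, hF, map_zero, add_zero]
      refine (hA _ _).trans ?_
      rcases eq_or_ne i j with rfl | h
      · exact (Matrix.blockDiagonal'_apply_eq _ _ _ _).trans
          (Matrix.blockDiagonal'_apply_eq (fun i => N (Sum.elim blk blk' i)) (Sum.inl i) r s).symm
      · exact (Matrix.blockDiagonal'_apply_ne _ _ _ h).trans (Matrix.blockDiagonal'_apply_ne
          (fun i => N (Sum.elim blk blk' i)) _ _ (Sum.inl_injective.ne h)).symm
    have hrr : ∀ i j (r : (blk' i).Idx) (s : (blk' j).Idx),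
        F (c ⟨Sum.inr i, r⟩) (c ⟨Sum.inr j, s⟩) =
        Matrix.blockDiagonal' (fun i => N (Sum.elim blk blk' i)) ⟨Sum.inr i, r⟩ ⟨Sum.inr j, s⟩ := by
      intro i j r s
      rw [hcr, hcr, hF, map_zero]
      refine (zero_add _).trans ?_
      refine (hA' _ _).trans ?_
      rcases eq_or_ne i j with rfl | h
      · exact (Matrix.blockDiagonal'_apply_eq _ _ _ _).trans
          (Matrix.blockDiagonal'_apply_eq (fun i => N (Sum.elim blk blk' i)) (Sum.inr i) r s).symm
      · exact (Matrix.blockDiagonal'_apply_ne _ _ _ h).trans (Matrix.blockDiagonal'_apply_ne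
          (fun i => N (Sum.elim blk blk' i)) _ _ (Sum.inr_injective.ne h)).symm
    rintro ⟨i | i, r⟩ ⟨j | j, s⟩
    · exact hll i j r s
    · exact (congrArg₂ (fun u v => F u v) (hcl i r) (hcr j s)).trans <|
        (by simp [hF] : F (b ⟨i, r⟩, 0) (0, b' ⟨j, s⟩) = 0).trans (Matrix.blockDiagonal'_apply_ne
          (fun i => N (Sum.elim blk blk' i)) _ _ Sum.inl_ne_inr).symm
    · exact (congrArg₂ (fun u v => F u v) (hcr i r) (hcl j s)).trans <|
        (by simp [hF] : F (0, b' ⟨i, r⟩) (b ⟨j, s⟩, 0) = 0).trans (Matrix.blockDiagonal'_apply_ne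
          (fun i => N (Sum.elim blk blk' i)) _ _ Sum.inr_ne_inl).symm
    · exact hrr i j r s
  refine ⟨ι ⊕ κ, inferInstance, inferInstance, Sum.elim blk blk', c, ?_,
    key JKBlock.matA A A' F hA hA' hF, key JKBlock.matB B B' G hB hB' hG, ?_⟩
  · rintro (i | i)
    exacts [hp i, hp' i]
  · rw [← JKType.ofBlocks_add_kronecker _ _ hK]
    congr 1
    rw [← Finset.univ_disjSum_univ, Finset.val_disjSum, Multiset.disjSum, Multiset.map_add,
      Multiset.map_map, Multiset.map_map]
    rfl

/-! ### Zariski open sets -/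

section Zariski

variable {W W' : Type*} [AddCommGroup W] [Module ℂ W] [AddCommGroup W'] [Module ℂ W']

/-- Polynomial functions on a vector space. -/
def IsPolynomialFun (f : W → ℂ) : Prop :=
  ∃ P : MvPolynomial (Module.Dual ℂ W) ℂ, ∀ w, f w = MvPolynomial.eval (fun φ => φ w) P

theorem IsPolynomialFun.const (c : ℂ) : IsPolynomialFun fun _ : W => c :=
  ⟨MvPolynomial.C c, by simp⟩

theorem IsPolynomialFun.dual (φ : Module.Dual ℂ W) : IsPolynomialFun fun w : W => φ w :=
  ⟨MvPolynomial.X φ, by simp⟩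

theorem IsPolynomialFun.add {f g : W → ℂ} (hf : IsPolynomialFun f) (hg : IsPolynomialFun g) :
    IsPolynomialFun fun w => f w + g w := by
  obtain ⟨P, hP⟩ := hf
  obtain ⟨Q, hQ⟩ := hg
  exact ⟨P + Q, by simp [hP, hQ]⟩

theorem IsPolynomialFun.sub {f g : W → ℂ} (hf : IsPolynomialFun f) (hg : IsPolynomialFun g) :
    IsPolynomialFun fun w => f w - g w := by
  obtain ⟨P, hP⟩ := hf
  obtain ⟨Q, hQ⟩ := hg
  exact ⟨P - Q, by simp [hP, hQ]⟩

theorem IsPolynomialFun.mul {f g : W → ℂ} (hf : IsPolynomialFun f) (hg : IsPolynomialFun g) :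
    IsPolynomialFun fun w => f w * g w := by
  obtain ⟨P, hP⟩ := hf
  obtain ⟨Q, hQ⟩ := hg
  exact ⟨P * Q, by simp [hP, hQ]⟩

theorem IsPolynomialFun.isZariskiOpen {f : W → ℂ} (hf : IsPolynomialFun f) :
    IsZariskiOpen {w | f w ≠ 0} := by
  obtain ⟨P, hP⟩ := hf
  exact ⟨{P}, by simp [hP]⟩

theorem isZariskiOpen_univ : IsZariskiOpen (Set.univ : Set W) :=
  ⟨{1}, by simp⟩

theorem IsZariskiOpen.inter {U U' : Set W} (hU : IsZariskiOpen U) (hU' : IsZariskiOpen U') :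
    IsZariskiOpen (U ∩ U') := by
  obtain ⟨S, rfl⟩ := hU
  obtain ⟨S', rfl⟩ := hU'
  refine ⟨{R | ∃ P ∈ S, ∃ Q ∈ S', R = P * Q}, ?_⟩
  ext w
  constructor
  · rintro ⟨⟨P, hP, hP0⟩, Q, hQ, hQ0⟩
    exact ⟨P * Q, ⟨P, hP, Q, hQ, rfl⟩, by rw [map_mul]; exact mul_ne_zero hP0 hQ0⟩
  · rintro ⟨_, ⟨P, hP, Q, hQ, rfl⟩, h0⟩
    rw [map_mul] at h0
    exact ⟨⟨P, hP, left_ne_zero_of_mul h0⟩, Q, hQ, right_ne_zero_of_mul h0⟩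

/-- The index ranges over a `Sort`, so that side conditions such as `i ≠ j` can also serve as
indices. -/
theorem IsZariskiOpen.forall_finite {ι : Sort*} [Finite ι] {p : ι → W → Prop}
    (h : ∀ i, IsZariskiOpen {w | p i w}) : IsZariskiOpen {w | ∀ i, p i w} := by
  have key : ∀ s : Set (PLift ι), s.Finite → IsZariskiOpen {w | ∀ i ∈ s, p i.down w} := by
    intro s hs
    induction s, hs using Set.Finite.induction_on with
    | empty => simpa using isZariskiOpen_univ
    | insert _ _ ih =>
      rename_i a s _ _
      convert (h a.down).inter ih using 1
      ext w
      simp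
  convert key Set.univ (Set.toFinite _) using 1
  ext w
  simp [PLift.forall]

theorem IsZariskiOpen.preimage {U : Set W'} (hU : IsZariskiOpen U) (f : W →ₗ[ℂ] W') :
    IsZariskiOpen (f ⁻¹' U) := by
  obtain ⟨S, rfl⟩ := hU
  refine ⟨MvPolynomial.rename (fun φ : Module.Dual ℂ W' => φ ∘ₗ f) '' S, ?_⟩
  ext w
  simp [MvPolynomial.eval_rename, Function.comp_def]

end Zariski

/-! ### Products of Lie algebras -/

/-- A functional on the product is a pair of functionals on the factors, and its form is the
orthogonal sum of theirs; the open sets are pulled back along restriction. Tuples are grouped by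
eigenvalue, so Jordan blocks in both factors could merge; `hT'` excludes this. -/
theorem HasJKInvariants.prod_kronecker {L L' : Type*} [LieRing L] [LieAlgebra ℂ L] [LieRing L']
    [LieAlgebra ℂ L'] {T T' : JKType} (h : HasJKInvariants L T) (h' : HasJKInvariants L' T')
    (hT' : T'.jordan = 0) :
    HasJKInvariants (L × L') ⟨T.jordan, T.kronecker + T'.kronecker⟩ := by
  obtain ⟨U, hU, ⟨u, hu⟩, hUT⟩ := h
  obtain ⟨U', hU', ⟨u', hu'⟩, hUT'⟩ := h'
  let res := (LinearMap.inl ℂ L L').dualMap.prodMap (LinearMap.inl ℂ L L').dualMap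
  let res' := (LinearMap.inr ℂ L L').dualMap.prodMap (LinearMap.inr ℂ L L').dualMap
  refine ⟨res ⁻¹' U ∩ res' ⁻¹' U', (hU.preimage _).inter (hU'.preimage _), ?_, ?_⟩
  · refine ⟨(u.1.coprod u'.1, u.2.coprod u'.2), ?_, ?_⟩
    · have : res (u.1.coprod u'.1, u.2.coprod u'.2) = u := by ext <;> simp [res]
      rwa [Set.mem_preimage, this]
    · have : res' (u.1.coprod u'.1, u.2.coprod u'.2) = u' := by ext <;> simp [res']
      rwa [Set.mem_preimage, this]
  · rintro ⟨x, a⟩ ⟨hq, hq'⟩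
    have hform : ∀ (y : Module.Dual ℂ (L × L')) (v w : L × L'),
        lieForm y v w = lieForm ((LinearMap.inl ℂ L L').dualMap y) v.1 w.1 +
          lieForm ((LinearMap.inr ℂ L L').dualMap y) v.2 w.2 := by
      intro y v w
      simp [lieForm, ← map_add]
    exact (hUT _ hq).prod_kronecker (hUT' _ hq') hT' (hform x) (hform a)

/-! ### Semidirect products of abelian Lie algebras -/

/-- The semidirect product of the abelian Lie algebra `U` with its representation `ρ` by commuting
operators on `V`, where `V` is an abelian ideal. -/
def AbelianSemidirect {U V : Type} [AddCommGroup U] [Module ℂ U] [AddCommGroup V] [Module ℂ V]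
    (ρ : U →ₗ[ℂ] Module.End ℂ V) (_ : ∀ u u', Commute (ρ u) (ρ u')) : Type :=
  U × V

namespace AbelianSemidirect

variable {U V : Type} [AddCommGroup U] [Module ℂ U] [AddCommGroup V] [Module ℂ V]
  (ρ : U →ₗ[ℂ] Module.End ℂ V) (h : ∀ u u', Commute (ρ u) (ρ u'))

instance : AddCommGroup (AbelianSemidirect ρ h) := inferInstanceAs (AddCommGroup (U × V))

instance : Module ℂ (AbelianSemidirect ρ h) := inferInstanceAs (Module ℂ (U × V))

/-- The identity map from the underlying vector space. -/
def ofProd : (U × V) ≃ₗ[ℂ] AbelianSemidirect ρ h := LinearEquiv.refl ℂ (U × V)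

instance : Bracket (AbelianSemidirect ρ h) (AbelianSemidirect ρ h) where
  bracket x y := ofProd ρ h
    (0, ρ ((ofProd ρ h).symm x).1 ((ofProd ρ h).symm y).2
      - ρ ((ofProd ρ h).symm y).1 ((ofProd ρ h).symm x).2)

theorem ofProd_lie_ofProd (x y : U × V) :
    ⁅ofProd ρ h x, ofProd ρ h y⁆ = ofProd ρ h (0, ρ x.1 y.2 - ρ y.1 x.2) := rfl

instance : LieRing (AbelianSemidirect ρ h) where
  add_lie x y z := by
    obtain ⟨x, rfl⟩ := (ofProd ρ h).surjective x
    obtain ⟨y, rfl⟩ := (ofProd ρ h).surjective y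
    obtain ⟨z, rfl⟩ := (ofProd ρ h).surjective z
    simp only [← map_add, ofProd_lie_ofProd]
    simp
    abel
  lie_add x y z := by
    obtain ⟨x, rfl⟩ := (ofProd ρ h).surjective x
    obtain ⟨y, rfl⟩ := (ofProd ρ h).surjective y
    obtain ⟨z, rfl⟩ := (ofProd ρ h).surjective z
    simp only [← map_add, ofProd_lie_ofProd]
    simp
    abel
  lie_self x := by
    obtain ⟨x, rfl⟩ := (ofProd ρ h).surjective x
    simp [ofProd_lie_ofProd]
  leibniz_lie x y z := by
    obtain ⟨x, rfl⟩ := (ofProd ρ h).surjective x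
    obtain ⟨y, rfl⟩ := (ofProd ρ h).surjective y
    obtain ⟨z, rfl⟩ := (ofProd ρ h).surjective z
    -- Every double bracket is a combination of terms `ρ u (ρ u' v)`, so the Jacobi identity reduces
    -- to interchanging the two operators.
    have hc : ∀ u u' v, ρ u (ρ u' v) = ρ u' (ρ u v) := fun u u' v =>
      LinearMap.congr_fun (h u u').eq v
    simp only [← map_add, ofProd_lie_ofProd]
    simp only [map_sub, map_zero, LinearMap.zero_apply, Prod.mk_add_mk, add_zero]
    rw [hc x.1 y.1, hc x.1 z.1, hc y.1 z.1]
    congr 2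
    abel

instance : LieAlgebra ℂ (AbelianSemidirect ρ h) where
  lie_smul c x y := by
    obtain ⟨x, rfl⟩ := (ofProd ρ h).surjective x
    obtain ⟨y, rfl⟩ := (ofProd ρ h).surjective y
    simp only [← map_smul, ofProd_lie_ofProd]
    simp [smul_sub]

end AbelianSemidirect

/-- Commuting operators on `V`, together with `V` as an abelian ideal, form a Lie algebra. -/
theorem exists_lieAlgebra_of_commute {I J V : Type} [Fintype I] [DecidableEq I]
    [AddCommGroup V] [Module ℂ V] (v : Module.Basis J ℂ V) (M : I → Module.End ℂ V)
    (hM : ∀ i i', Commute (M i) (M i')) :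
    ∃ (L : Type) (_ : LieRing L) (_ : LieAlgebra ℂ L) (b : Module.Basis (I ⊕ J) ℂ L)
      (ψ : V →ₗ[ℂ] L), (∀ j, b (Sum.inr j) = ψ (v j)) ∧ (∀ w w', ⁅ψ w, ψ w'⁆ = 0) ∧
      (∀ i i', ⁅b (Sum.inl i), b (Sum.inl i')⁆ = 0) ∧
      ∀ i w, ⁅b (Sum.inl i), ψ w⁆ = ψ (M i w) := by
  let ρ : (I → ℂ) →ₗ[ℂ] Module.End ℂ V := Fintype.linearCombination ℂ M
  have hρ : ∀ u u', Commute (ρ u) (ρ u') := by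
    intro u u'
    simp only [ρ, Fintype.linearCombination_apply]
    exact Commute.sum_left _ _ _ fun i _ => Commute.sum_right _ _ _ fun i' _ =>
      ((hM i i').smul_left _).smul_right _
  let φ := AbelianSemidirect.ofProd ρ hρ
  let b := ((Pi.basisFun ℂ I).prod v).map φ
  have hl : ∀ i, b (Sum.inl i) = φ (Pi.single i 1, 0) := fun i => by
    simp only [b, Module.Basis.map_apply]
    congr 1
    ext <;> simp
  have hr : ∀ j, b (Sum.inr j) = φ (0, v j) := fun i => by
    simp only [b, Module.Basis.map_apply]
    congr 1
    ext <;> simp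
  refine ⟨AbelianSemidirect ρ hρ, inferInstance, inferInstance, b,
    φ.toLinearMap ∘ₗ LinearMap.inr ℂ (I → ℂ) V, ?_, ?_, ?_, ?_⟩
  · intro j
    rw [hr]; rfl
  · intro w w'
    simp [φ, AbelianSemidirect.ofProd_lie_ofProd]
  · intro i i'
    simp [hl, φ, AbelianSemidirect.ofProd_lie_ofProd]
  · intro i w
    simp [hl, φ, AbelianSemidirect.ofProd_lie_ofProd, ρ, Fintype.linearCombination_apply_single]

/-! ### Lie algebras with a single Kronecker block -/

theorem isPolynomialFun_fst_apply {L : Type*} [AddCommGroup L] [Module ℂ L] (v : L) :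
    IsPolynomialFun fun q : Module.Dual ℂ L × Module.Dual ℂ L => q.1 v :=
  IsPolynomialFun.dual
    (Module.Dual.eval ℂ L v ∘ₗ LinearMap.fst ℂ (Module.Dual ℂ L) (Module.Dual ℂ L))

theorem isPolynomialFun_snd_apply {L : Type*} [AddCommGroup L] [Module ℂ L] (v : L) :
    IsPolynomialFun fun q : Module.Dual ℂ L × Module.Dual ℂ L => q.2 v :=
  IsPolynomialFun.dual
    (Module.Dual.eval ℂ L v ∘ₗ LinearMap.snd ℂ (Module.Dual ℂ L) (Module.Dual ℂ L))

theorem lieForm_apply {L : Type*} [LieRing L] [LieAlgebra ℂ L] (x : Module.Dual ℂ L) (u v : L) :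
    lieForm x u v = x ⁅u, v⁆ := rfl

theorem JKType.ofBlocks_singleton_kronecker (m : ℕ) :
    JKType.ofBlocks {JKBlock.kronecker m} = ⟨0, {2 * m + 1}⟩ := by
  have h0 : Multiset.filterMap JKBlock.eigenvalue? {JKBlock.kronecker m} = 0 :=
    Multiset.filterMap_cons_none _ _ rfl
  have h1 : Multiset.filterMap JKBlock.kroneckerSize? {JKBlock.kronecker m} = {2 * m + 1} :=
    Multiset.filterMap_cons_some _ _ _ rfl
  simp [JKType.ofBlocks, h0, h1]

theorem exists_hasJKInvariants_kronecker (m : ℕ) :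
    ∃ (L : Type) (_ : LieRing L) (_ : LieAlgebra ℂ L),
      FiniteDimensional ℂ L ∧ HasJKInvariants L ⟨0, {2 * m + 1}⟩ := by
  let v := Pi.basisFun ℂ (Fin (m + 1))
  -- The weights are chosen so that `w i j` times the value of a functional on the `j`-th basis
  -- vector of the ideal is the `(i, j)` entry of `starMatrix`.
  let w : Fin m → Fin (m + 1) → ℂ := fun i => Fin.cons (-1) fun k => if i = k then 1 else 0
  let M : Fin m → Module.End ℂ (Fin (m + 1) → ℂ) := fun i => v.constr ℂ fun j => w i j • v j
  have hMv : ∀ i j, M i (v j) = w i j • v j := fun i j => v.constr_basis ℂ _ j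
  obtain ⟨L, _, _, b, ψ, hψ, hJJ, hII, hIJ⟩ := exists_lieAlgebra_of_commute v M fun i i' =>
    v.ext fun j => by simp [hMv, smul_comm (w i j)]
  have hlie : ∀ i j, ⁅b (Sum.inl i), b (Sum.inr j)⁆ = w i j • b (Sum.inr j) := fun i j => by
    rw [hψ, hIJ, hMv, map_smul]
  refine ⟨L, _, _, Module.Basis.finiteDimensional_of_finite b,
    {q | ∀ j, q.1 (b (Sum.inr j)) ≠ 0} ∩ {q | ∀ i j, i ≠ j →
      q.2 (b (Sum.inr i)) * q.1 (b (Sum.inr j)) - q.2 (b (Sum.inr j)) * q.1 (b (Sum.inr i)) ≠ 0},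
    ?_, ?_, ?_⟩
  · refine (IsZariskiOpen.forall_finite fun j => ?_).inter
      (IsZariskiOpen.forall_finite fun i => IsZariskiOpen.forall_finite fun j =>
        IsZariskiOpen.forall_finite fun _ => ?_)
    · exact (isPolynomialFun_fst_apply _).isZariskiOpen
    · exact (((isPolynomialFun_snd_apply _).mul (isPolynomialFun_fst_apply _)).sub
        ((isPolynomialFun_snd_apply _).mul (isPolynomialFun_fst_apply _))).isZariskiOpen
  · refine ⟨(b.constr ℂ fun _ => (1 : ℂ), b.constr ℂ (Sum.elim 0 fun j => (j.val : ℂ))), ?_, ?_⟩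
    · intro j
      simp
    · intro i j hij
      simpa [Module.Basis.constr_basis, sub_eq_zero, Fin.val_inj] using hij
  · rintro ⟨x, a⟩ ⟨hx, hxa⟩
    obtain ⟨P, R, hP, hR, hL, hR'⟩ := exists_starMatrix_normalForm (x := fun j => x (b (Sum.inr j)))
      (a := fun j => a (b (Sum.inr j))) hx (by
        intro i j hij
        by_contra hne
        refine hxa i j hne (sub_eq_zero.2 ?_)
        exact (div_eq_div_iff (hx i) (hx j)).1 hij)
    let c : Module.Basis (Σ _ : Unit, (JKBlock.kronecker m).Idx) ℂ L :=
      b.reindex (Equiv.uniqueSigma fun _ : Unit => (JKBlock.kronecker m).Idx).symm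
    have key : ∀ (y : Module.Dual ℂ L) r s, lieForm y (c r) (c s) = Matrix.blockDiagonal'
        (fun _ : Unit => JKBlock.skew (starMatrix m fun j => y (b (Sum.inr j)))) r s := by
      have hc : ∀ r, c ⟨(), r⟩ = b r := fun r => b.reindex_apply _ _
      have hst : ∀ (y : Module.Dual ℂ L) i j,
          w i j * y (b (Sum.inr j)) = starMatrix m (fun j => y (b (Sum.inr j))) i j := by
        intro y i j
        refine Fin.cases ?_ (fun j => ?_) j
        · simp [w, starMatrix]
        · rcases eq_or_ne i j with rfl | h
          · simp [w, starMatrix]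
          · simp [w, starMatrix, h]
      rintro y ⟨⟨⟩, r⟩ ⟨⟨⟩, s⟩
      rw [hc, hc, lieForm_apply]
      refine Eq.trans ?_ (Matrix.blockDiagonal'_apply_eq _ _ _ _).symm
      rcases r with i | j <;> rcases s with i' | j'
      · rw [hII]
        simp [JKBlock.skew]
      · rw [hlie, map_smul, smul_eq_mul, hst]
        simp [JKBlock.skew]
      · rw [← lie_skew, hlie, map_neg, map_smul, smul_eq_mul, hst]
        simp [JKBlock.skew]
      · rw [hψ, hψ, hJJ]
        simp [JKBlock.skew]
    have := HasAlgebraicType.of_congruent_blocks (blk := fun _ : Unit => JKBlock.kronecker m)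
      (fun _ => trivial) c _ _ (fun _ => Matrix.fromBlocks P.transpose 0 0 R) (key x) (key a)
      (fun _ => isUnit_fromBlocks_transpose hP hR)
      (fun _ => fromBlocks_transpose_mul_skew_mul _ _ _ _ hL)
      (fun _ => fromBlocks_transpose_mul_skew_mul _ _ _ _ hR')
    rwa [Finset.univ_unique, Finset.singleton_val, Multiset.map_singleton,
      JKType.ofBlocks_singleton_kronecker] at this

/-! ### Existence of the Lie algebra with one Kronecker `3 × 3` block -/

section Kron3Existence

variable {N : ℕ} (p : Fin N → ℕ) (n : (t : Fin N) → Fin (p t) → ℕ)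

/-- The index set of the vectors `e^i_{tj}`. -/
abbrev Kron3Pos : Type := Σ y : Σ t, Fin (p t), Fin (n y.1 y.2)

/-- The basis splits into `g, f^i_{tj}` and `h₁, h₂, e^i_{tj}`. -/
def kron3IdxEquiv : (Unit ⊕ Kron3Pos p n) ⊕ (Bool ⊕ Kron3Pos p n) ≃ Kron3Idx p n where
  toFun
    | .inl (.inl _) => .g
    | .inl (.inr ⟨⟨t, i⟩, j⟩) => .f t i j
    | .inr (.inl false) => .h₁
    | .inr (.inl true) => .h₂
    | .inr (.inr ⟨⟨t, i⟩, j⟩) => .e t i j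
  invFun
    | .g => .inl (.inl ())
    | .f t i j => .inl (.inr ⟨⟨t, i⟩, j⟩)
    | .h₁ => .inr (.inl false)
    | .h₂ => .inr (.inl true)
    | .e t i j => .inr (.inr ⟨⟨t, i⟩, j⟩)
  left_inv := by rintro ((_ | ⟨⟨_, _⟩, _⟩) | ((_ | _) | ⟨⟨_, _⟩, _⟩)) <;> rfl
  right_inv := by rintro (_ | _ | _ | _ | _) <;> rfl

theorem exists_kron3Relations (α β : Fin N → ℂ) :
    ∃ (L : Type) (_ : LieRing L) (_ : LieAlgebra ℂ L) (b : Module.Basis (Kron3Idx p n) ℂ L),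
      Kron3Relations α β b := by
  let v := Pi.basisFun ℂ (Bool ⊕ Kron3Pos p n)
  -- `E y` is the whole chain, with `α h₁ + β h₂` in place `0` and the zero-based vector `e r` in
  -- place `r + 1`. The cases `j > k` and `j = k` of the relations then become the single formula
  -- `[e_j, f_k] = E y (j - k)`. The sign in `F` turns `[e, f]` into `[f, e]`.
  let E : (Σ t, Fin (p t)) → ℕ → (Bool ⊕ Kron3Pos p n → ℂ) := fun y r => match r with
    | 0 => α y.1 • v (.inl false) + β y.1 • v (.inl true)
    | r + 1 => if h : r < n y.1 y.2 then v (.inr ⟨y, ⟨r, h⟩⟩) else 0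
  let F : Kron3Pos p n → Module.End ℂ (Bool ⊕ Kron3Pos p n → ℂ) := fun z => v.constr ℂ <|
    Sum.elim (fun _ => 0) fun w =>
      if z.1 = w.1 ∧ z.2.val ≤ w.2.val then -E w.1 (w.2.val - z.2.val) else 0
  let M : Unit ⊕ Kron3Pos p n → Module.End ℂ (Bool ⊕ Kron3Pos p n → ℂ) :=
    Sum.elim (fun _ => 1) F
  have hFh : ∀ z c, F z (v (.inl c)) = 0 := fun z c => v.constr_basis ℂ _ _
  have hFe : ∀ z w, F z (v (.inr w)) =
      if z.1 = w.1 ∧ z.2.val ≤ w.2.val then -E w.1 (w.2.val - z.2.val) else 0 :=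
    fun z w => v.constr_basis ℂ _ _
  have hEs : ∀ y r (h : r < n y.1 y.2), E y (r + 1) = v (.inr ⟨y, ⟨r, h⟩⟩) :=
    fun y r h => dif_pos h
  have hFE : ∀ z y r, r ≤ n y.1 y.2 → F z (E y r) =
      if z.1 = y ∧ z.2.val + 1 ≤ r then -E y (r - (z.2.val + 1)) else 0 := by
    rintro z y (_ | r) hr
    · simp [E, hFh]
    · have hr' : r < n y.1 y.2 := hr
      rw [hEs y r hr', hFe]
      simp
  -- The result is symmetric in `z` and `z'`, which gives commutativity. The `+ 1` comes from
  -- zero-based indices: `f k` lowers the chain by `k + 1` places.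
  have hFF : ∀ z z' w, F z (F z' (v (.inr w))) =
      if z.1 = w.1 ∧ z'.1 = w.1 ∧ z.2.val + z'.2.val + 1 ≤ w.2.val then
        E w.1 (w.2.val - (z.2.val + z'.2.val + 1)) else 0 := by
    intro z z' w
    rw [hFe]
    by_cases h : z'.1 = w.1 ∧ z'.2.val ≤ w.2.val
    · rw [if_pos h, map_neg, hFE _ _ _ (by have := w.2.isLt; omega)]
      by_cases h' : z.1 = w.1 ∧ z.2.val + 1 ≤ w.2.val - z'.2.val
      · rw [if_pos h', if_pos ⟨h'.1, h.1, by omega⟩, neg_neg]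
        congr 1
        omega
      · rw [if_neg h', if_neg, neg_zero]
        rintro ⟨h1, -, h3⟩
        exact h' ⟨h1, by omega⟩
    · rw [if_neg h, map_zero, if_neg]
      rintro ⟨-, h2, h3⟩
      exact h ⟨h2, by omega⟩
  obtain ⟨L, _, _, b, ψ, hψ, hJJ, hII, hIJ⟩ := exists_lieAlgebra_of_commute v M (by
    have hcomm : ∀ z z', Commute (F z) (F z') := by
      refine fun z z' => v.ext ?_
      rintro (c | w)
      · simp [hFh]
      · change F z (F z' (v (.inr w))) = F z' (F z (v (.inr w)))
        rw [hFF, hFF, add_comm z.2.val]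
        exact if_congr (by tauto) rfl rfl
    rintro (_ | z) (_ | z')
    exacts [Commute.refl _, Commute.one_left _, Commute.one_right _, hcomm z z'])
  let c := b.reindex (kron3IdxEquiv p n)
  have hg : c .g = b (.inl (.inl ())) := b.reindex_apply _ _
  have hf : ∀ t i j, c (.f t i j) = b (.inl (.inr ⟨⟨t, i⟩, j⟩)) := fun _ _ _ => b.reindex_apply _ _
  have hh₁ : c .h₁ = ψ (v (.inl false)) := (b.reindex_apply _ _).trans (hψ _)
  have hh₂ : c .h₂ = ψ (v (.inl true)) := (b.reindex_apply _ _).trans (hψ _)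
  have he : ∀ t i j, c (.e t i j) = ψ (v (.inr ⟨⟨t, i⟩, j⟩)) :=
    fun _ _ _ => (b.reindex_apply _ _).trans (hψ _)
  have hef : ∀ t i j s l k, ⁅c (.e t i j), c (.f s l k)⁆ =
      ψ (if (⟨s, l⟩ : Σ t, Fin (p t)) = ⟨t, i⟩ ∧ k.val ≤ j.val then
        E ⟨t, i⟩ (j.val - k.val) else 0) := by
    intro t i j s l k
    rw [← lie_skew, he, hf, hIJ, ← map_neg]
    change ψ (-F _ _) = _
    rw [hFe]
    split_ifs <;> simp
  have hgψ : ∀ w, ⁅c .g, ψ w⁆ = ψ w := fun w => by rw [hg, hIJ]; rfl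
  have hfh : ∀ t i j d, ⁅ψ (v (.inl d)), c (.f t i j)⁆ = 0 := by
    intro t i j d
    rw [← lie_skew, hf, hIJ]
    change -ψ (F _ _) = _
    rw [hFh, map_zero, neg_zero]
  refine ⟨L, _, _, c, ?_⟩
  constructor
  · rw [hh₁, hgψ]
  · rw [hh₂, hgψ]
  · intro t i j
    rw [he, hgψ]
  · intro t i j k hkj
    rw [hef, if_pos ⟨rfl, hkj.le⟩, he]
    have hr : j.val - k.val = (j.val - k.val - 1) + 1 := by
      rw [Fin.lt_def] at hkj
      omega
    exact congrArg ψ ((congrArg (E ⟨t, i⟩) hr).trans (hEs ⟨t, i⟩ _ (by simp only; omega)))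
  · intro t i j
    rw [hef, if_pos ⟨rfl, le_rfl⟩, hh₁, hh₂, ← ψ.map_smul, ← ψ.map_smul, ← ψ.map_add, Nat.sub_self]
  · intro t i j k hjk
    rw [hef, if_neg (fun h => h.2.not_gt hjk), map_zero]
  · intro t i j s l k hne
    rw [hef, if_neg (fun h => hne h.1.symm), map_zero]
  · intro t i j
    rw [hg, hf, hII]
  · rw [hh₁, hh₂, hJJ]
  · intro t i j
    rw [hh₁, he, hJJ]
  · intro t i j
    rw [hh₁, hfh]
  · intro t i j
    rw [hh₂, he, hJJ]
  · intro t i j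
    rw [hh₂, hfh]
  · intro t i j s l k
    rw [he, he, hJJ]
  · intro t i j s l k
    rw [hf, hf, hII]

end Kron3Existence

/-! ### The invariants of the Lie algebra with one Kronecker `3 × 3` block -/

section Kron3Invariants

variable {N : ℕ} {p : Fin N → ℕ} {n : (t : Fin N) → Fin (p t) → ℕ}

/-- One Kronecker `3 × 3` block and Jordan blocks of sizes `2n_{ti}` with eigenvalues `μ_t`. -/
def kron3Block (n : (t : Fin N) → Fin (p t) → ℕ) (μ : Fin N → ℂ) :
    Option (Σ t, Fin (p t)) → JKBlock
  | none => .kronecker 1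
  | some y => .jordan (μ y.1 : ℂ) (n y.1 y.2)

/-- Since `μ` is injective, grouping by eigenvalue is grouping by `t`. Positivity of `p t` ensures
that each `μ t` occurs; otherwise `kron3Type` would contain an empty tuple. -/
theorem JKType.ofBlocks_kron3Block (hp : ∀ t, 0 < p t) {μ : Fin N → ℂ}
    (hμ : Function.Injective μ) :
    JKType.ofBlocks (Finset.univ.val.map (kron3Block n μ)) = kron3Type p n := by
  classical
  have huniv : (Finset.univ : Finset (Option (Σ t, Fin (p t)))).val =
      none ::ₘ (Finset.univ : Finset (Σ t, Fin (p t))).val.map some := rfl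
  set S := (Finset.univ : Finset (Σ t, Fin (p t))).val with hS
  have hblk : Finset.univ.val.map (kron3Block n μ) = JKBlock.kronecker 1 ::ₘ
      S.map fun y => JKBlock.jordan (μ y.1 : ℂ) (n y.1 y.2) := by
    rw [huniv, Multiset.map_cons, Multiset.map_map]
    rfl
  have hk : ∀ R : Multiset (Σ t, Fin (p t)), (R.map fun y =>
      JKBlock.jordan (μ y.1 : ℂ) (n y.1 y.2)).filterMap JKBlock.kroneckerSize? = 0 := by
    intro R
    induction R using Multiset.induction_on with
    | empty => rfl
    | cons a R ih => rw [Multiset.map_cons, Multiset.filterMap_cons_none _ _ rfl, ih]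
  have he : ∀ R : Multiset (Σ t, Fin (p t)), (R.map fun y =>
      JKBlock.jordan (μ y.1 : ℂ) (n y.1 y.2)).filterMap JKBlock.eigenvalue? =
      R.map fun y => (μ y.1 : OnePoint ℂ) := by
    intro R
    induction R using Multiset.induction_on with
    | empty => rfl
    | cons a R ih =>
      rw [Multiset.map_cons, Multiset.filterMap_cons_some JKBlock.eigenvalue? _ _ rfl, ih,
        Multiset.map_cons]
  have hj : ∀ (t : Fin N) (R : Multiset (Σ t, Fin (p t))), (R.map fun y =>
      JKBlock.jordan (μ y.1 : ℂ) (n y.1 y.2)).filterMap (JKBlock.jordanSize? (μ t : OnePoint ℂ)) =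
      (R.filter fun y => y.1 = t).map fun y => 2 * n y.1 y.2 := by
    intro t R
    induction R using Multiset.induction_on with
    | empty => rfl
    | cons a R ih =>
      rw [Multiset.map_cons]
      by_cases h : a.1 = t
      · rw [Multiset.filterMap_cons_some (b := 2 * n a.1 a.2), ih,
          Multiset.filter_cons_of_pos (p := fun y : Σ t, Fin (p t) => y.1 = t) _ h, Multiset.map_cons]
        simp [JKBlock.jordanSize?, h]
      · rw [Multiset.filterMap_cons_none, ih,
          Multiset.filter_cons_of_neg (p := fun y : Σ t, Fin (p t) => y.1 = t) _ h]
        have : μ a.1 ≠ μ t := hμ.ne h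
        simp [JKBlock.jordanSize?, this]
  rw [hblk]
  ext1
  · have hfin : (S.map fun y => (μ y.1 : OnePoint ℂ)).toFinset =
        Finset.univ.map ⟨fun t => (μ t : OnePoint ℂ), OnePoint.coe_injective.comp hμ⟩ := by
      ext ν
      simp only [Multiset.mem_toFinset, Multiset.mem_map, Finset.mem_map, Finset.mem_univ,
        true_and, Function.Embedding.coeFn_mk]
      constructor
      · rintro ⟨y, -, rfl⟩
        exact ⟨y.1, rfl⟩
      · rintro ⟨t, rfl⟩
        exact ⟨⟨t, ⟨0, hp t⟩⟩, Finset.mem_univ _, rfl⟩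
    have hfilter : ∀ t, S.filter (fun y => y.1 = t) =
        (Finset.univ : Finset (Fin (p t))).val.map (Sigma.mk t) := by
      intro t
      have : (Finset.univ : Finset (Σ t, Fin (p t))).filter (fun y => y.1 = t) =
          Finset.univ.map ⟨Sigma.mk t, sigma_mk_injective⟩ := by
        ext ⟨s, i⟩
        simp only [Finset.mem_filter, Finset.mem_univ, true_and, Finset.mem_map,
          Function.Embedding.coeFn_mk]
        constructor
        · rintro rfl
          exact ⟨i, rfl⟩
        · rintro ⟨j, hj⟩
          exact (congrArg Sigma.fst hj).symm
      exact congrArg Finset.val this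
    simp only [JKType.ofBlocks, kron3Type]
    rw [Multiset.filterMap_cons_none _ _ rfl, he]
    have : (S.map fun y => (μ y.1 : OnePoint ℂ)).toFinset.val =
        Finset.univ.val.map fun t => (μ t : OnePoint ℂ) := by
      rw [hfin]; rfl
    rw [show ∀ inst : DecidableEq (OnePoint ℂ), @Multiset.toFinset _ inst
      (S.map fun y => (μ y.1 : OnePoint ℂ)) = (S.map fun y => (μ y.1 : OnePoint ℂ)).toFinset by
        intro inst; congr!, this, Multiset.map_map]
    refine Multiset.map_congr rfl fun t _ => ?_
    rw [Function.comp_apply, Multiset.filterMap_cons_none _ _ rfl, hj, hfilter, Multiset.map_map]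
    rfl
  · simp only [JKType.ofBlocks, kron3Type]
    rw [Multiset.filterMap_cons_some JKBlock.kroneckerSize? _ _ rfl, hk]
    rfl

/-- The blocks of the basis `g, h₁, h₂, e^i_{tj}, f^i_{tj}`. -/
def kron3BlockEquiv (n : (t : Fin N) → Fin (p t) → ℕ) (μ : Fin N → ℂ) :
    (Σ o, (kron3Block n μ o).Idx) ≃ Kron3Idx p n where
  toFun
    | ⟨none, (r : Fin 1 ⊕ Fin 2)⟩ => Sum.elim (fun _ => .g) ![.h₁, .h₂] r
    | ⟨some y, (r : Fin (n y.1 y.2) ⊕ Fin (n y.1 y.2))⟩ => Sum.elim (.e y.1 y.2) (.f y.1 y.2) r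
  invFun
    | .g => ⟨none, (.inl 0 : Fin 1 ⊕ Fin 2)⟩
    | .h₁ => ⟨none, (.inr 0 : Fin 1 ⊕ Fin 2)⟩
    | .h₂ => ⟨none, (.inr 1 : Fin 1 ⊕ Fin 2)⟩
    | .e t i j => ⟨some ⟨t, i⟩, (.inl j : Fin (n t i) ⊕ Fin (n t i))⟩
    | .f t i j => ⟨some ⟨t, i⟩, (.inr j : Fin (n t i) ⊕ Fin (n t i))⟩
  left_inv := by
    rintro ⟨_ | ⟨t, i⟩, r⟩
    · change Fin 1 ⊕ Fin 2 at r
      rcases r with r | r <;> fin_cases r <;> rfl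
    · change Fin (n t i) ⊕ Fin (n t i) at r
      rcases r with r | r <;> rfl
  right_inv := by rintro (_ | _ | _ | _ | _) <;> rfl

variable {α β : Fin N → ℂ} {L : Type*} [LieRing L] [LieAlgebra ℂ L]
  {b : Module.Basis (Kron3Idx p n) ℂ L}

/-- The values of a linear functional on `α_t h₁ + β_t h₂, e^i_{t1}, e^i_{t2}, …`. -/
noncomputable def kron3Coeff (α β : Fin N → ℂ) (b : Module.Basis (Kron3Idx p n) ℂ L) (y : Module.Dual ℂ L)
    (t : Fin N) (i : Fin (p t)) : ℕ → ℂ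
  | 0 => α t * y (b .h₁) + β t * y (b .h₂)
  | r + 1 => if h : r < n t i then y (b (.e t i ⟨r, h⟩)) else 0

/-- The bracket depends only on `j - k` and vanishes for `j < k`, whence a lower triangular Toeplitz
matrix. -/
theorem Kron3Relations.apply_e_f (hb : Kron3Relations α β b) (y : Module.Dual ℂ L) (t i)
    (j k : Fin (n t i)) :
    y ⁅b (.e t i j), b (.f t i k)⁆ = lowerToeplitz (n t i) (kron3Coeff α β b y t i) j k := by
  rcases lt_trichotomy k j with h | rfl | h
  · have hr : j.val - k.val = (j.val - k.val - 1) + 1 := by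
      rw [Fin.lt_def] at h
      omega
    have hlt : j.val - k.val - 1 < n t i := by omega
    have hc : kron3Coeff α β b y t i ((j.val - k.val - 1) + 1) =
        y (b (.e t i ⟨j.val - k.val - 1, hlt⟩)) := dif_pos hlt
    rw [hb.e_f_gt t i j k h]
    simp only [lowerToeplitz, Matrix.of_apply, if_pos h.le]
    exact hc.symm.trans (congrArg (kron3Coeff α β b y t i) hr.symm)
  · rw [hb.e_f_eq]
    simp [lowerToeplitz, kron3Coeff]
  · rw [hb.e_f_lt t i j k h]
    simp [lowerToeplitz, h.not_ge]

/-- The matrices of the blocks of the form of `y`, where `u` is its value on `h₁, h₂`. -/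
def kron3Mat (μ : Fin N → ℂ) (c : (t : Fin N) → Fin (p t) → ℕ → ℂ) (u : Fin 2 → ℂ) :
    ∀ o, Matrix (kron3Block n μ o).Idx (kron3Block n μ o).Idx ℂ
  | none => JKBlock.skew (Matrix.of fun (_ : Fin 1) j => u j)
  | some y => JKBlock.skew (lowerToeplitz (n y.1 y.2) (c y.1 y.2))

/-- The matrix of the form of `y` after a change of basis in `h₁, h₂` and a shift of the vectors
`e^i_{tj}` along `h₁, h₂` to the kernel of `y`. -/
theorem Kron3Relations.lieForm_eq (hb : Kron3Relations α β b) {c : Kron3Idx p n → L}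
    {P Q : Fin 2 → ℂ} {κ ν : (t : Fin N) → (i : Fin (p t)) → Fin (n t i) → ℂ}
    (hg : c .g = b .g) (hh₁ : c .h₁ = P 0 • b .h₁ + Q 0 • b .h₂)
    (hh₂ : c .h₂ = P 1 • b .h₁ + Q 1 • b .h₂)
    (he : ∀ t i j, c (.e t i j) = b (.e t i j) - κ t i j • c .h₁ - ν t i j • c .h₂)
    (hf : ∀ t i j, c (.f t i j) = b (.f t i j))
    (y : Module.Dual ℂ L) (hy : ∀ t i j, y (c (.e t i j)) = 0) (μ : Fin N → ℂ)
    (r s : Σ o, (kron3Block n μ o).Idx) :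
    lieForm y (c (kron3BlockEquiv n μ r)) (c (kron3BlockEquiv n μ s)) =
      Matrix.blockDiagonal' (kron3Mat μ (kron3Coeff α β b y) ![y (c .h₁), y (c .h₂)]) r s := by
  have hswap : ⁅b .h₂, b .h₁⁆ = 0 := by rw [← lie_skew, hb.h_h, neg_zero]
  have he₁ : ∀ t i j, ⁅b (.e t i j), b .h₁⁆ = 0 := fun t i j => by
    rw [← lie_skew, hb.h₁_e, neg_zero]
  have he₂ : ∀ t i j, ⁅b (.e t i j), b .h₂⁆ = 0 := fun t i j => by
    rw [← lie_skew, hb.h₂_e, neg_zero]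
  have gh₁ : ⁅c .g, c .h₁⁆ = c .h₁ := by simp [hg, hh₁, hb.g_h₁, hb.g_h₂]
  have gh₂ : ⁅c .g, c .h₂⁆ = c .h₂ := by simp [hg, hh₂, hb.g_h₁, hb.g_h₂]
  have ge : ∀ t i j, ⁅c .g, c (.e t i j)⁆ = c (.e t i j) := fun t i j => by
    rw [he, lie_sub, lie_sub, lie_smul, lie_smul, gh₁, gh₂, hg, hb.g_e]
  have gf : ∀ t i j, ⁅c .g, c (.f t i j)⁆ = 0 := fun t i j => by rw [hg, hf, hb.g_f]
  have hh : ⁅c .h₁, c .h₂⁆ = 0 := by simp [hh₁, hh₂, hb.h_h, hswap]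
  have h₁e : ∀ t i j, ⁅c .h₁, c (.e t i j)⁆ = 0 := fun t i j => by
    rw [he, lie_sub, lie_sub, lie_smul, lie_smul, hh, lie_self]
    simp [hh₁, hb.h₁_e, hb.h₂_e]
  have h₂e : ∀ t i j, ⁅c .h₂, c (.e t i j)⁆ = 0 := fun t i j => by
    rw [he, lie_sub, lie_sub, lie_smul, lie_smul, ← lie_skew (c .h₂) (c .h₁), hh, lie_self]
    simp [hh₂, hb.h₁_e, hb.h₂_e]
  have h₁f : ∀ t i j, ⁅c .h₁, c (.f t i j)⁆ = 0 := fun t i j => by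
    simp [hh₁, hf, hb.h₁_f, hb.h₂_f]
  have h₂f : ∀ t i j, ⁅c .h₂, c (.f t i j)⁆ = 0 := fun t i j => by
    simp [hh₂, hf, hb.h₁_f, hb.h₂_f]
  have ee : ∀ t i j t' i' j', ⁅c (.e t i j), c (.e t' i' j')⁆ = 0 := fun t i j t' i' j' => by
    rw [he t i j, sub_lie, sub_lie, smul_lie, smul_lie, h₁e, h₂e, he]
    simp [hh₁, hh₂, hb.e_e, he₁, he₂]
  have ff : ∀ t i j t' i' j', ⁅c (.f t i j), c (.f t' i' j')⁆ = 0 := fun t i j t' i' j' => by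
    rw [hf, hf, hb.f_f]
  -- The shift along `h₁, h₂` is invisible here because these commute with every `f`.
  have ef : ∀ t i j t' i' j', ⁅c (.e t i j), c (.f t' i' j')⁆ = ⁅b (.e t i j), b (.f t' i' j')⁆ :=
    fun t i j t' i' j' => by
      rw [he, sub_lie, sub_lie, smul_lie, smul_lie, h₁f, h₂f, hf]
      simp
  have skew : ∀ u v : L, lieForm y u v = -lieForm y v u := fun u v => by
    rw [lieForm_apply, lieForm_apply, ← map_neg, lie_skew]
  set NA := kron3Mat (n := n) μ (kron3Coeff α β b y) ![y (c .h₁), y (c .h₂)] with hNA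
  have hne : ∀ o o' q q', o ≠ o' → Matrix.blockDiagonal' NA ⟨o, q⟩ ⟨o', q'⟩ = 0 :=
    fun o o' q q' h => Matrix.blockDiagonal'_apply_ne _ _ _ h
  have heq : ∀ o q q', Matrix.blockDiagonal' NA ⟨o, q⟩ ⟨o, q'⟩ = NA o q q' :=
    fun o q q' => Matrix.blockDiagonal'_apply_eq _ _ _ _
  -- As `[g, e] = e`, orthogonality of `g` to the shifted `e`'s is exactly `hy`; this is what
  -- separates the Kronecker block from the Jordan blocks.
  have main : ∀ z q s,
      lieForm y (c (kron3BlockEquiv n μ ⟨none, q⟩)) (c (kron3BlockEquiv n μ ⟨some z, s⟩)) = 0 := by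
    rintro z (q : Fin 1 ⊕ Fin 2) (s : Fin (n z.1 z.2) ⊕ Fin (n z.1 z.2))
    rcases s with s | s
    · change lieForm y (c (Sum.elim (fun _ => .g) ![.h₁, .h₂] q)) (c (.e z.1 z.2 s)) = 0
      rcases q with q | q <;> fin_cases q <;> simp [lieForm_apply, ge, hy, h₁e, h₂e]
    · change lieForm y (c (Sum.elim (fun _ => .g) ![.h₁, .h₂] q)) (c (.f z.1 z.2 s)) = 0
      rcases q with q | q <;> fin_cases q <;> simp [lieForm_apply, gf, h₁f, h₂f]
  obtain ⟨_ | z, r⟩ := r <;> obtain ⟨_ | w, s⟩ := s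
  · rw [heq]
    change Fin 1 ⊕ Fin 2 at r s
    change lieForm y (c (Sum.elim (fun _ => .g) ![.h₁, .h₂] r))
      (c (Sum.elim (fun _ => .g) ![.h₁, .h₂] s)) =
      JKBlock.skew (Matrix.of fun (_ : Fin 1) j => ![y (c .h₁), y (c .h₂)] j) r s
    rcases r with r | r <;> rcases s with s | s
    · simp [JKBlock.skew, lieForm_apply]
    · fin_cases s <;> simp [JKBlock.skew, lieForm_apply, gh₁, gh₂]
    · rw [skew]
      fin_cases r <;> simp [JKBlock.skew, lieForm_apply, gh₁, gh₂]
    · have hh' : ⁅c .h₂, c .h₁⁆ = 0 := by rw [← lie_skew, hh, neg_zero]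
      fin_cases r <;> fin_cases s <;> simp [JKBlock.skew, lieForm_apply, hh, hh']
  · rw [hne _ _ _ _ (by simp)]
    exact main w r s
  · rw [hne _ _ _ _ (by simp), skew, neg_eq_zero]
    exact main z s r
  · by_cases hzw : z = w
    · subst hzw
      rw [heq]
      change Fin (n z.1 z.2) ⊕ Fin (n z.1 z.2) at r s
      change lieForm y (c (Sum.elim (.e z.1 z.2) (.f z.1 z.2) r))
        (c (Sum.elim (.e z.1 z.2) (.f z.1 z.2) s)) =
        JKBlock.skew (lowerToeplitz (n z.1 z.2) (kron3Coeff α β b y z.1 z.2)) r s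
      rcases r with r | r <;> rcases s with s | s
      · simp [JKBlock.skew, lieForm_apply, ee]
      · simp [JKBlock.skew, lieForm_apply, ef, hb.apply_e_f]
      · rw [skew]
        simp [JKBlock.skew, lieForm_apply, ef, hb.apply_e_f]
      · simp [JKBlock.skew, lieForm_apply, ff]
    · rw [hne _ _ _ _ (fun h => hzw (Option.some_injective _ h))]
      change Fin (n z.1 z.2) ⊕ Fin (n z.1 z.2) at r
      change Fin (n w.1 w.2) ⊕ Fin (n w.1 w.2) at s
      change lieForm y (c (Sum.elim (.e z.1 z.2) (.f z.1 z.2) r))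
        (c (Sum.elim (.e w.1 w.2) (.f w.1 w.2) s)) = 0
      rcases r with r | r <;> rcases s with s | s
      · simp [lieForm_apply, ee]
      · simp [lieForm_apply, ef, hb.e_f_ne _ _ _ _ _ _ hzw]
      · rw [skew]
        simp [lieForm_apply, ef, hb.e_f_ne _ _ _ _ _ _ (Ne.symm hzw)]
      · simp [lieForm_apply, ff]

end Kron3Invariants

/-! ### Genericity conditions and the type of a generic pencil. -/

section Kron3Invariants

variable {N : ℕ} {p : Fin N → ℕ} {n : (t : Fin N) → Fin (p t) → ℕ} {α β : Fin N → ℂ}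
  {L : Type*} [LieRing L] [LieAlgebra ℂ L] {b : Module.Basis (Kron3Idx p n) ℂ L}

theorem isPolynomialFun_kron3Coeff_fst (t : Fin N) (i : Fin (p t)) (r : ℕ) :
    IsPolynomialFun fun q : Module.Dual ℂ L × Module.Dual ℂ L => kron3Coeff α β b q.1 t i r := by
  rcases r with _ | r
  · exact ((IsPolynomialFun.const _).mul (isPolynomialFun_fst_apply _)).add
      ((IsPolynomialFun.const _).mul (isPolynomialFun_fst_apply _))
  · by_cases h : r < n t i
    · simpa [kron3Coeff, h] using isPolynomialFun_fst_apply (b (.e t i ⟨r, h⟩))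
    · simpa [kron3Coeff, h] using IsPolynomialFun.const (W := Module.Dual ℂ L × Module.Dual ℂ L) 0

theorem isPolynomialFun_kron3Coeff_snd (t : Fin N) (i : Fin (p t)) (r : ℕ) :
    IsPolynomialFun fun q : Module.Dual ℂ L × Module.Dual ℂ L => kron3Coeff α β b q.2 t i r := by
  rcases r with _ | r
  · exact ((IsPolynomialFun.const _).mul (isPolynomialFun_snd_apply _)).add
      ((IsPolynomialFun.const _).mul (isPolynomialFun_snd_apply _))
  · by_cases h : r < n t i
    · simpa [kron3Coeff, h] using isPolynomialFun_snd_apply (b (.e t i ⟨r, h⟩))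
    · simpa [kron3Coeff, h] using IsPolynomialFun.const (W := Module.Dual ℂ L × Module.Dual ℂ L) 0

/-- The pencils satisfying the genericity conditions have the expected type. -/
theorem Kron3Relations.hasAlgebraicType (hb : Kron3Relations α β b) (hp : ∀ t, 0 < p t)
    (hn : ∀ t i, 0 < n t i) {x a : Module.Dual ℂ L}
    (hΔ : x (b .h₁) * a (b .h₂) - x (b .h₂) * a (b .h₁) ≠ 0)
    (ha : ∀ t, α t * a (b .h₁) + β t * a (b .h₂) ≠ 0)
    (hxa : ∀ t i, 1 < n t i → kron3Coeff α β b x t i 1 * kron3Coeff α β b a t i 0 -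
      kron3Coeff α β b x t i 0 * kron3Coeff α β b a t i 1 ≠ 0)
    (hμ : Function.Injective fun t => (α t * x (b .h₁) + β t * x (b .h₂)) /
      (α t * a (b .h₁) + β t * a (b .h₂))) :
    HasAlgebraicType (lieForm x) (lieForm a) (kron3Type p n) := by
  set μ : Fin N → ℂ := fun t => (α t * x (b .h₁) + β t * x (b .h₂)) /
      (α t * a (b .h₁) + β t * a (b .h₂)) with hμdef
  set Δ := x (b .h₁) * a (b .h₂) - x (b .h₂) * a (b .h₁) with hΔdef
  -- By Cramer's rule `H 0, H 1` is the basis of the span of `h₁, h₂` dual to the restrictions of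
  -- `x, a`. Consequently the shifted vectors `c (.e t i j)` below are killed by both functionals.
  let P : Fin 2 → ℂ := ![a (b .h₂) / Δ, -x (b .h₂) / Δ]
  let Q : Fin 2 → ℂ := ![-a (b .h₁) / Δ, x (b .h₁) / Δ]
  let H : Fin 2 → L := fun k => P k • b .h₁ + Q k • b .h₂
  let c : Kron3Idx p n → L := fun
    | .g => b .g
    | .h₁ => H 0
    | .h₂ => H 1
    | .e t i j => b (.e t i j) - x (b (.e t i j)) • H 0 - a (b (.e t i j)) • H 1
    | .f t i j => b (.f t i j)
  have hx0 : x (H 0) = 1 := by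
    simp only [H, P, Q, map_add, map_smul, smul_eq_mul, Matrix.cons_val_zero]
    field_simp
    rw [hΔdef]; ring
  have hx1 : x (H 1) = 0 := by
    simp only [H, P, Q, map_add, map_smul, smul_eq_mul, Matrix.cons_val_one,
      Matrix.cons_val_fin_one]
    field_simp
    ring
  have ha0 : a (H 0) = 0 := by
    simp only [H, P, Q, map_add, map_smul, smul_eq_mul, Matrix.cons_val_zero]
    field_simp
    ring
  have ha1 : a (H 1) = 1 := by
    simp only [H, P, Q, map_add, map_smul, smul_eq_mul, Matrix.cons_val_one,
      Matrix.cons_val_fin_one]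
    field_simp
    rw [hΔdef]; ring
  have hspan : ⊤ ≤ Submodule.span ℂ (Set.range c) := by
    have hmem : ∀ k, c k ∈ Submodule.span ℂ (Set.range c) := fun k =>
      Submodule.subset_span (Set.mem_range_self k)
    have hH0 := hmem .h₁
    have hH1 := hmem .h₂
    rw [← b.span_eq, Submodule.span_le]
    rintro _ ⟨_ | _ | _ | ⟨t, i, j⟩ | ⟨t, i, j⟩, rfl⟩
    · exact hmem .g
    · have : b .h₁ = x (b .h₁) • H 0 + a (b .h₁) • H 1 := by
        simp only [H, P, Q, Matrix.cons_val_zero, Matrix.cons_val_one, Matrix.cons_val_fin_one]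
        match_scalars
        · field_simp
          rw [hΔdef]; ring
        · field_simp
          ring
      rw [this]
      exact add_mem (Submodule.smul_mem _ _ hH0) (Submodule.smul_mem _ _ hH1)
    · have : b .h₂ = x (b .h₂) • H 0 + a (b .h₂) • H 1 := by
        simp only [H, P, Q, Matrix.cons_val_zero, Matrix.cons_val_one, Matrix.cons_val_fin_one]
        match_scalars
        · field_simp
          rw [hΔdef]; ring
        · field_simp
          ring
      rw [this]
      exact add_mem (Submodule.smul_mem _ _ hH0) (Submodule.smul_mem _ _ hH1)
    · have : b (.e t i j) =
          c (.e t i j) + x (b (.e t i j)) • H 0 + a (b (.e t i j)) • H 1 := by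
        simp only [c]
        abel
      rw [this]
      exact add_mem (add_mem (hmem (.e t i j)) (Submodule.smul_mem _ _ hH0)) (Submodule.smul_mem _ _ hH1)
    · exact hmem (.f t i j)
  let _ : Fintype (Kron3Idx p n) := Fintype.ofEquiv _ (kron3IdxEquiv p n)
  let cb := basisOfTopLeSpanOfCardEqFinrank c hspan (Module.finrank_eq_card_basis b).symm
  let c' := cb.reindex (kron3BlockEquiv n μ).symm
  have hc' : ∀ r, c' r = c (kron3BlockEquiv n μ r) := fun r => by
    rw [Module.Basis.reindex_apply, coe_basisOfTopLeSpanOfCardEqFinrank]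
    rfl
  have hform : ∀ y : Module.Dual ℂ L, (∀ t i j, y (c (.e t i j)) = 0) → ∀ r s,
      lieForm y (c' r) (c' s) =
        Matrix.blockDiagonal' (kron3Mat μ (kron3Coeff α β b y) ![y (H 0), y (H 1)]) r s := by
    intro y hy r s
    rw [hc', hc']
    exact hb.lieForm_eq (c := c) (P := P) (Q := Q) rfl rfl rfl (fun _ _ _ => rfl)
      (fun _ _ _ => rfl) y hy μ r s
  have hA := hform x fun t i j => by simp [c, hx0, hx1]
  have hB := hform a fun t i j => by simp [c, ha0, ha1]
  rw [hx0, hx1] at hA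
  rw [ha0, ha1] at hB
  have hJ := fun z : Σ t, Fin (p t) => exists_lowerToeplitz_normalForm (hn z.1 z.2)
    (X := kron3Coeff α β b x z.1 z.2) (Y := kron3Coeff α β b a z.1 z.2) (ha z.1) (hxa z.1 z.2)
  choose S R hS hR hSA hSB using hJ
  rw [← JKType.ofBlocks_kron3Block hp hμ]
  -- The triple `g, H 0, H 1` is already in normal form, so only the Jordan blocks need a further
  -- change of basis.
  let M : ∀ o, Matrix (kron3Block n μ o).Idx (kron3Block n μ o).Idx ℂ := fun
    | none => (1 : Matrix (Fin 1 ⊕ Fin 2) (Fin 1 ⊕ Fin 2) ℂ)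
    | some z => Matrix.fromBlocks (S z).transpose 0 0 (R z)
  refine HasAlgebraicType.of_congruent_blocks ?_ c' _ _ M hA hB ?_ ?_ ?_
  · rintro (_ | z)
    exacts [trivial, hn z.1 z.2]
  · rintro (_ | z)
    · exact isUnit_one
    · exact isUnit_fromBlocks_transpose (hS z) (hR z)
  · rintro (_ | z)
    · change (1 : Matrix (Fin 1 ⊕ Fin 2) (Fin 1 ⊕ Fin 2) ℂ).transpose *
        JKBlock.skew (Matrix.of fun (_ : Fin 1) j => ![1, 0] j) *
        (1 : Matrix (Fin 1 ⊕ Fin 2) (Fin 1 ⊕ Fin 2) ℂ) = JKBlock.skew (JKBlock.leftShift 1)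
      rw [Matrix.transpose_one, Matrix.one_mul, Matrix.mul_one]
      congr 1
      ext i j
      fin_cases i; fin_cases j <;> simp [JKBlock.leftShift]
    · exact fromBlocks_transpose_mul_skew_mul _ _ _ _ (hSA z)
  · rintro (_ | z)
    · change (1 : Matrix (Fin 1 ⊕ Fin 2) (Fin 1 ⊕ Fin 2) ℂ).transpose *
        JKBlock.skew (Matrix.of fun (_ : Fin 1) j => ![0, 1] j) *
        (1 : Matrix (Fin 1 ⊕ Fin 2) (Fin 1 ⊕ Fin 2) ℂ) = JKBlock.skew (JKBlock.rightShift 1)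
      rw [Matrix.transpose_one, Matrix.one_mul, Matrix.mul_one]
      congr 1
      ext i j
      fin_cases i; fin_cases j <;> simp [JKBlock.rightShift]
    · exact fromBlocks_transpose_mul_skew_mul _ _ _ _ (hSB z)

/-- Distinctness of the eigenvalues need not be imposed on the open set: it follows from the
independence of `x, a` on `h₁, h₂` and the non-proportionality of the `(α_t, β_t)`. -/
theorem Kron3Relations.hasJKInvariants (hb : Kron3Relations α β b) (hp : ∀ t, 0 < p t)
    (hn : ∀ t i, 0 < n t i) (hαβ : ∀ t, (α t, β t) ≠ (0, 0))
    (hprop : ∀ s t, s ≠ t → ¬ ∃ c : ℂ, (α s, β s) = c • (α t, β t)) :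
    HasJKInvariants L (kron3Type p n) := by
  refine ⟨{q | q.1 (b .h₁) * q.2 (b .h₂) - q.1 (b .h₂) * q.2 (b .h₁) ≠ 0} ∩
    ({q | ∀ t, α t * q.2 (b .h₁) + β t * q.2 (b .h₂) ≠ 0} ∩
    {q | ∀ t i, 1 < n t i → kron3Coeff α β b q.1 t i 1 * kron3Coeff α β b q.2 t i 0 -
      kron3Coeff α β b q.1 t i 0 * kron3Coeff α β b q.2 t i 1 ≠ 0}), ?_, ?_, ?_⟩
  · refine IsZariskiOpen.inter ?_ (.inter (.forall_finite fun t => ?_)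
      (.forall_finite fun t => .forall_finite fun i => .forall_finite fun _ => ?_))
    · exact (((isPolynomialFun_fst_apply _).mul (isPolynomialFun_snd_apply _)).sub
        ((isPolynomialFun_fst_apply _).mul (isPolynomialFun_snd_apply _))).isZariskiOpen
    · exact (((IsPolynomialFun.const _).mul (isPolynomialFun_snd_apply _)).add
        ((IsPolynomialFun.const _).mul (isPolynomialFun_snd_apply _))).isZariskiOpen
    · exact (((isPolynomialFun_kron3Coeff_fst t i 1).mul
        (isPolynomialFun_kron3Coeff_snd t i 0)).sub ((isPolynomialFun_kron3Coeff_fst t i 0).mul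
        (isPolynomialFun_kron3Coeff_snd t i 1))).isZariskiOpen
  · obtain ⟨s, hs⟩ := (Set.finite_range fun t => -β t / α t).exists_notMem
    have hs0 : ∀ t, α t * s + β t ≠ 0 := by
      intro t h
      by_cases h0 : α t = 0
      · rw [h0, zero_mul, zero_add] at h
        exact hαβ t (by rw [h0, h])
      · refine hs ⟨t, ?_⟩
        simp only
        rw [div_eq_iff h0]
        linear_combination -h
    let x : Module.Dual ℂ L := b.constr ℂ fun
      | .h₁ => (1 : ℂ)
      | .e _ _ _ => 1
      | _ => 0
    let a : Module.Dual ℂ L := b.constr ℂ fun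
      | .h₁ => s
      | .h₂ => 1
      | _ => 0
    have hx₁ : x (b .h₁) = 1 := b.constr_basis ℂ _ _
    have hx₂ : x (b .h₂) = 0 := b.constr_basis ℂ _ _
    have hxe : ∀ t i j, x (b (.e t i j)) = 1 := fun _ _ _ => b.constr_basis ℂ _ _
    have ha₁ : a (b .h₁) = s := b.constr_basis ℂ _ _
    have ha₂ : a (b .h₂) = 1 := b.constr_basis ℂ _ _
    have hae : ∀ t i j, a (b (.e t i j)) = 0 := fun _ _ _ => b.constr_basis ℂ _ _
    refine ⟨(x, a), ?_, ?_, ?_⟩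
    · simp [hx₁, hx₂, ha₁, ha₂]
    · intro t
      simpa [ha₁, ha₂] using hs0 t
    · intro t i hi
      have : 0 < n t i := by omega
      simpa [kron3Coeff, this, hxe, hae, ha₁, ha₂] using hs0 t
  · rintro ⟨x, a⟩ ⟨hΔ, ha, hxa⟩
    refine hb.hasAlgebraicType hp hn hΔ ha hxa fun s t hst => ?_
    by_contra hne
    have h := (div_eq_div_iff (ha s) (ha t)).1 hst
    -- The cross-multiplied difference of the two eigenvalues is this determinant times the one that
    -- is nonzero by `hΔ`.
    have hdet : α s * β t - β s * α t = 0 := by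
      refine (mul_eq_zero.1 ?_).resolve_right hΔ
      simp only
      simp only at h
      linear_combination h
    by_cases h0 : α t = 0
    · have hβ : β t ≠ 0 := fun h1 => hαβ t (by rw [h0, h1])
      refine hprop s t hne ⟨β s / β t, Prod.ext ?_ ?_⟩
      · have : α s * β t = 0 := by rw [h0] at hdet; linear_combination hdet
        simp [h0, (mul_eq_zero.1 this).resolve_right hβ]
      · simp [hβ]
    · refine hprop s t hne ⟨α s / α t, Prod.ext ?_ ?_⟩
      · simp [h0]
      · simp only [Prod.smul_mk, smul_eq_mul]
        field_simp
        linear_combination -hdet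

end Kron3Invariants

/-! ### Realization of Jordan tuples and Kronecker sizes -/

theorem Multiset.map_univ_get_toList {γ : Type*} (s : Multiset γ) :
    (Finset.univ : Finset (Fin s.toList.length)).val.map s.toList.get = s := by
  rw [Fin.univ_val_map, List.ofFn_get, Multiset.coe_toList]

/-- Listing the tuples and their entries gives `N`, `p` and `n`; halving loses nothing because the
entries are even. -/
theorem exists_kron3Type_jordan_eq {J : Multiset (Multiset ℕ)}
    (hJ : ∀ S ∈ J, S ≠ 0 ∧ ∀ d ∈ S, 0 < d ∧ Even d) :
    ∃ (N : ℕ) (p : Fin N → ℕ) (n : (t : Fin N) → Fin (p t) → ℕ), (∀ t, 0 < p t) ∧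
      (∀ t i, 0 < n t i) ∧ (kron3Type p n).jordan = J := by
  have hmem : ∀ t, J.toList.get t ∈ J := fun t => Multiset.mem_toList.1 (List.get_mem _ _)
  have hmem' : ∀ t i, (J.toList.get t).toList.get i ∈ J.toList.get t :=
    fun t i => Multiset.mem_toList.1 (List.get_mem _ _)
  refine ⟨J.toList.length, fun t => (J.toList.get t).toList.length,
    fun t i => (J.toList.get t).toList.get i / 2, fun t => ?_, fun t i => ?_, ?_⟩
  · exact (Multiset.card_pos.2 (hJ _ (hmem t)).1).trans_eq (Multiset.length_toList _).symm
  · obtain ⟨h0, d, hd⟩ := (hJ _ (hmem t)).2 _ (hmem' t i)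
    simp only
    omega
  · have key : ∀ t, ((Finset.univ : Finset (Fin (J.toList.get t).toList.length)).val.map fun i =>
        2 * ((J.toList.get t).toList.get i / 2)) = J.toList.get t := by
      intro t
      refine (Multiset.map_congr rfl fun i _ => ?_).trans (Multiset.map_univ_get_toList _)
      obtain ⟨-, d, hd⟩ := (hJ _ (hmem t)).2 _ (hmem' t i)
      omega
    exact (Multiset.map_congr rfl fun t _ => key t).trans (Multiset.map_univ_get_toList J)

theorem exists_hasJKInvariants_add_kronecker {T : JKType} {L : Type} [LieRing L] [LieAlgebra ℂ L]
    [FiniteDimensional ℂ L] (hL : HasJKInvariants L T) (K : Multiset ℕ) (hK : ∀ d ∈ K, Odd d) :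
    ∃ (L' : Type) (_ : LieRing L') (_ : LieAlgebra ℂ L'),
      FiniteDimensional ℂ L' ∧ HasJKInvariants L' ⟨T.jordan, T.kronecker + K⟩ := by
  induction K using Multiset.induction_on with
  | empty => exact ⟨L, _, _, ‹_›, by simpa using hL⟩
  | cons d K ih =>
    obtain ⟨L₁, _, _, _, h₁⟩ := ih fun d hd => hK d (Multiset.mem_cons_of_mem hd)
    obtain ⟨m, rfl⟩ := hK d (Multiset.mem_cons_self d K)
    obtain ⟨L₂, _, _, _, h₂⟩ := exists_hasJKInvariants_kronecker m
    refine ⟨L₁ × L₂, _, _, inferInstance, ?_⟩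
    convert h₁.prod_kronecker h₂ rfl using 2
    simp only
    rw [add_assoc, ← Multiset.singleton_add (2 * m + 1) K, add_comm K]

theorem mainTheorem6 :
    (∀ (N : ℕ) (p : Fin N → ℕ) (n : (t : Fin N) → Fin (p t) → ℕ) (α β : Fin N → ℂ),
      (∀ t, 0 < p t) →
      (∀ t i, 0 < n t i) →
      (∀ t, (α t, β t) ≠ (0, 0)) →
      (∀ s t, s ≠ t → ¬ ∃ c : ℂ, (α s, β s) = c • (α t, β t)) →
      (∃ (L : Type) (_ : LieRing L) (_ : LieAlgebra ℂ L) (b : Module.Basis (Kron3Idx p n) ℂ L),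
        Kron3Relations α β b) ∧
      ∀ (L : Type*) [LieRing L] [LieAlgebra ℂ L] (b : Module.Basis (Kron3Idx p n) ℂ L),
        Kron3Relations α β b → HasJKInvariants L (kron3Type p n)) ∧
    ∀ T : JKType, T.IsAdmissible → 3 ∈ T.kronecker →
      ∃ (L : Type) (_ : LieRing L) (_ : LieAlgebra ℂ L),
        FiniteDimensional ℂ L ∧ HasJKInvariants L T := by
  refine ⟨fun N p n α β hp hn hαβ hprop => ⟨exists_kron3Relations p n α β,
    fun L _ _ b hb => hb.hasJKInvariants hp hn hαβ hprop⟩, ?_⟩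
  rintro ⟨J, K⟩ ⟨hJ, hK⟩ h3
  -- One size `3` is provided by the algebra of part (1); the remaining sizes are added by taking
  -- products.
  obtain ⟨K, rfl⟩ := Multiset.exists_cons_of_mem h3
  obtain ⟨N, p, n, hp, hn, rfl⟩ := exists_kron3Type_jordan_eq hJ
  -- The pairs `(1, t)` are nonzero and pairwise non-proportional.
  obtain ⟨L, _, _, b, hb⟩ := exists_kron3Relations p n (fun _ => 1) fun t => (t.val : ℂ)
  have hL := hb.hasJKInvariants hp hn (by simp) (by
    rintro s t hst ⟨c, hc⟩
    simp only [Prod.smul_mk, smul_eq_mul, mul_one, Prod.mk.injEq] at hc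
    obtain ⟨rfl, hc⟩ := hc
    rw [one_mul] at hc
    exact hst (Fin.ext (Nat.cast_injective hc)))
  let _ : Fintype (Kron3Idx p n) := Fintype.ofEquiv _ (kron3IdxEquiv p n)
  have : FiniteDimensional ℂ L := Module.Basis.finiteDimensional_of_finite b
  obtain ⟨L', _, _, hfin, h⟩ := exists_hasJKInvariants_add_kronecker hL K fun d hd =>
    hK d (Multiset.mem_cons_of_mem hd)
  refine ⟨L', _, _, hfin, ?_⟩
  rwa [show (kron3Type p n).kronecker = {3} from rfl, Multiset.singleton_add] at h
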